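/- Let $\mathsf{Q}=\overline{U}_{\mathrm{i}}\,s\ell(2)$ be the restricted quantum group at $\mathfrak q=\mathrm i$: the unital associative $\mathbb{C}$-algebra with generators $E,F,K^{\pm1}$ and relations $KK^{-1}=K^{-1}K=1$, $KEK^{-1}=-E$, $KFK^{-1}=-F$, $EF-FE=\frac{K-K^{-1}}{\mathrm i-\mathrm i^{-1}}$, $E^2=F^2=0$, $K^4=1$, with comultiplication and counit the algebra homomorphisms given by $$\Delta(E)=1\otimes E+E\otimes K,\quad \Delta(F)=K^{-1}\otimes F+F\otimes 1,\quad \Delta(K)=K\otimes K,\qquad \epsilon(E)=\epsilon(F)=0,\ \epsilon(K)=1 .$$ Put $e_0=\tfrac12(1+K^2)$ and $e_1=\tfrac12(1-K^2)$. For $\varepsilon\in\{1,-1\}$ let $\phi_\varepsilon:\mathbb{Z}_2^3\to\mathbb{C}^*$ be given by $\phi_\varepsilon(1,1,1)=\varepsilon$ and $\phi_\varepsilon(i,j,k)=1$ if any of $i,j,k$ is $0$, and let $\Phi_\varepsilon=\sum_{i,j,k\in\mathbb{Z}_2}\phi_\varepsilon(i,j,k)\,e_i\otimes e_j\otimes e_k$.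 A quasi-bialgebra over $\mathbb{C}$ is an algebra $A$ with algebra homomorphisms $\Delta:A\to A\otimes A$, $\epsilon:A\to\mathbb{C}$ and an invertible $\Phi\in A^{\otimes3}$ such that $(\epsilon\otimes\mathrm{id})\Delta=\mathrm{id}=(\mathrm{id}\otimes\epsilon)\Delta$, $(\Delta\otimes\mathrm{id})(\Delta(a))=\Phi\,(\mathrm{id}\otimes\Delta)(\Delta(a))\,\Phi^{-1}$ for all $a\in A$, $(\mathrm{id}\otimes\epsilon\otimes\mathrm{id})(\Phi)=1\otimes1$, and $$(\Delta\otimes\mathrm{id}\otimes\mathrm{id})(\Phi)\,(\mathrm{id}\otimes\mathrm{id}\otimes\Delta)(\Phi)=(\Phi\otimes1)\,(\mathrm{id}\otimes\Delta\otimes\mathrm{id})(\Phi)\,(1\otimes\Phi).$$ It is quasi-triangular if it admits a universal R-matrix, that is, an invertible $R\in A\otimes A$ with $R\,\Delta(a)=\Delta^{\mathrm{op}}(a)\,R$ for all $a\in A$ and $$(\Delta\otimes\mathrm{id})(R)=\Phi_{231}^{-1}R_{13}\Phi_{132}R_{23}\Phi^{-1},\qquad(\mathrm{id}\otimes\Delta)(R)=\Phi_{312}R_{13}\Phi_{213}^{-1}R_{12}\Phi,$$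 where for $\Phi=\sum\Phi'\otimes\Phi''\otimes\Phi'''$ one writes $\Phi_{231}=\sum\Phi''\otimes\Phi'''\otimes\Phi'$, etc., and for $R=\sum R_1\otimes R_2$ one writes $R_{13}=\sum R_1\otimes1\otimes R_2$, etc. **Theorem.** For both $\varepsilon=1$ and $\varepsilon=-1$, $\phi_\varepsilon$ is a normalised $3$-cocycle of the group $\mathbb{Z}_2$ with values in $\mathbb{C}^*$, $\Phi_\varepsilon=1\otimes1\otimes1+(\varepsilon-1)\,e_1\otimes e_1\otimes e_1$, and $(\mathsf{Q},\Delta,\epsilon,\Phi_\varepsilon)$ is a quasi-bialgebra which is not quasi-triangular. In particular (case $\varepsilon=1$), the bialgebra $\mathsf{Q}$ has no universal R-matrix: there is no invertible $R\in\mathsf{Q}\otimes\mathsf{Q}$ with $R\,\Delta(a)=\Delta^{\mathrm{op}}(a)\,R$ for all $a\in\mathsf{Q}$, $(\Delta\otimes\mathrm{id})(R)=R_{13}R_{23}$ and $(\mathrm{id}\otimes\Delta)(R)=R_{13}R_{12}$. Moreover, the monoidal category of finite-dimensional complex representations of $\mathsf{Q}$, with the tensor product given by $\Delta$, the unit object $\mathbb{C}$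 given by $\epsilon$, and the associativity and unit isomorphisms of vector spaces, admits no braiding. -/

import Mathlib

open scoped TensorProduct
open CategoryTheory

noncomputable section

/-! ### Quasi-bialgebras and universal R-matrices over `ℂ` -/

namespace QB

variable {A : Type} [Ring A] [Algebra ℂ A]

/-- `Δ ⊗ id : A ⊗ A → A ⊗ A ⊗ A`; triple tensor products are bracketed to the right. -/
def comulLeft (Δ : A →ₐ[ℂ] A ⊗[ℂ] A) : A ⊗[ℂ] A →ₐ[ℂ] A ⊗[ℂ] (A ⊗[ℂ] A) :=
  (Algebra.TensorProduct.assoc ℂ ℂ ℂ A A A).toAlgHom.comp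
    (Algebra.TensorProduct.map Δ (AlgHom.id ℂ A))

/-- `id ⊗ Δ : A ⊗ A → A ⊗ A ⊗ A`. -/
def comulRight (Δ : A →ₐ[ℂ] A ⊗[ℂ] A) : A ⊗[ℂ] A →ₐ[ℂ] A ⊗[ℂ] (A ⊗[ℂ] A) :=
  Algebra.TensorProduct.map (AlgHom.id ℂ A) Δ

/-- `Δ ⊗ id ⊗ id : A ⊗ A ⊗ A → A ⊗ A ⊗ A ⊗ A`. -/
def comul₁ (Δ : A →ₐ[ℂ] A ⊗[ℂ] A) :
    A ⊗[ℂ] (A ⊗[ℂ] A) →ₐ[ℂ] A ⊗[ℂ] (A ⊗[ℂ] (A ⊗[ℂ] A)) :=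
  (Algebra.TensorProduct.assoc ℂ ℂ ℂ A A (A ⊗[ℂ] A)).toAlgHom.comp
    (Algebra.TensorProduct.map Δ (AlgHom.id ℂ (A ⊗[ℂ] A)))

/-- `id ⊗ Δ ⊗ id : A ⊗ A ⊗ A → A ⊗ A ⊗ A ⊗ A`. -/
def comul₂ (Δ : A →ₐ[ℂ] A ⊗[ℂ] A) :
    A ⊗[ℂ] (A ⊗[ℂ] A) →ₐ[ℂ] A ⊗[ℂ] (A ⊗[ℂ] (A ⊗[ℂ] A)) :=
  Algebra.TensorProduct.map (AlgHom.id ℂ A) (comulLeft Δ)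

/-- `id ⊗ id ⊗ Δ : A ⊗ A ⊗ A → A ⊗ A ⊗ A ⊗ A`. -/
def comul₃ (Δ : A →ₐ[ℂ] A ⊗[ℂ] A) :
    A ⊗[ℂ] (A ⊗[ℂ] A) →ₐ[ℂ] A ⊗[ℂ] (A ⊗[ℂ] (A ⊗[ℂ] A)) :=
  Algebra.TensorProduct.map (AlgHom.id ℂ A) (comulRight Δ)

/-- `x ↦ x ⊗ 1` from triple to fourfold tensors. -/
def tensorOne : A ⊗[ℂ] (A ⊗[ℂ] A) →ₐ[ℂ] A ⊗[ℂ] (A ⊗[ℂ] (A ⊗[ℂ] A)) :=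
  Algebra.TensorProduct.map (AlgHom.id ℂ A)
    (Algebra.TensorProduct.map (AlgHom.id ℂ A) Algebra.TensorProduct.includeLeft)

/-- `x ↦ 1 ⊗ x` from triple to fourfold tensors. -/
def oneTensor : A ⊗[ℂ] (A ⊗[ℂ] A) →ₐ[ℂ] A ⊗[ℂ] (A ⊗[ℂ] (A ⊗[ℂ] A)) :=
  Algebra.TensorProduct.includeRight

/-- `ϵ ⊗ id : A ⊗ A → A`. -/
def counitLeft (ϵ : A →ₐ[ℂ] ℂ) : A ⊗[ℂ] A →ₐ[ℂ] A :=
  (Algebra.TensorProduct.lid ℂ A).toAlgHom.comp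
    (Algebra.TensorProduct.map ϵ (AlgHom.id ℂ A))

/-- `id ⊗ ϵ : A ⊗ A → A`. -/
def counitRight (ϵ : A →ₐ[ℂ] ℂ) : A ⊗[ℂ] A →ₐ[ℂ] A :=
  (Algebra.TensorProduct.rid ℂ ℂ A).toAlgHom.comp
    (Algebra.TensorProduct.map (AlgHom.id ℂ A) ϵ)

/-- `id ⊗ ϵ ⊗ id : A ⊗ A ⊗ A → A ⊗ A`. -/
def counitMiddle (ϵ : A →ₐ[ℂ] ℂ) : A ⊗[ℂ] (A ⊗[ℂ] A) →ₐ[ℂ] A ⊗[ℂ] A :=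
  Algebra.TensorProduct.map (AlgHom.id ℂ A) (counitLeft ϵ)

/-- `a ⊗ b ⊗ c ↦ a ⊗ c ⊗ b`, i.e. `x ↦ x₁₃₂`. -/
def perm132 : A ⊗[ℂ] (A ⊗[ℂ] A) →ₐ[ℂ] A ⊗[ℂ] (A ⊗[ℂ] A) :=
  Algebra.TensorProduct.map (AlgHom.id ℂ A) (Algebra.TensorProduct.comm ℂ A A).toAlgHom

/-- `a ⊗ b ⊗ c ↦ b ⊗ a ⊗ c`, i.e. `x ↦ x₂₁₃`. -/
def perm213 : A ⊗[ℂ] (A ⊗[ℂ] A) →ₐ[ℂ] A ⊗[ℂ] (A ⊗[ℂ] A) :=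
  (Algebra.TensorProduct.leftComm ℂ A A A).toAlgHom

/-- `a ⊗ b ⊗ c ↦ b ⊗ c ⊗ a`, i.e. `x ↦ x₂₃₁`. -/
def perm231 : A ⊗[ℂ] (A ⊗[ℂ] A) →ₐ[ℂ] A ⊗[ℂ] (A ⊗[ℂ] A) :=
  perm132.comp perm213

/-- `a ⊗ b ⊗ c ↦ c ⊗ a ⊗ b`, i.e. `x ↦ x₃₁₂`. -/
def perm312 : A ⊗[ℂ] (A ⊗[ℂ] A) →ₐ[ℂ] A ⊗[ℂ] (A ⊗[ℂ] A) :=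
  perm213.comp perm132

/-- `r ⊗ s ↦ 1 ⊗ r ⊗ s`, i.e. `R ↦ R₂₃`. -/
def emb23 : A ⊗[ℂ] A →ₐ[ℂ] A ⊗[ℂ] (A ⊗[ℂ] A) :=
  Algebra.TensorProduct.includeRight

/-- `r ⊗ s ↦ r ⊗ 1 ⊗ s`, i.e. `R ↦ R₁₃`. -/
def emb13 : A ⊗[ℂ] A →ₐ[ℂ] A ⊗[ℂ] (A ⊗[ℂ] A) :=
  Algebra.TensorProduct.map (AlgHom.id ℂ A) Algebra.TensorProduct.includeRight

/-- `r ⊗ s ↦ r ⊗ s ⊗ 1`, i.e. `R ↦ R₁₂`. -/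
def emb12 : A ⊗[ℂ] A →ₐ[ℂ] A ⊗[ℂ] (A ⊗[ℂ] A) :=
  Algebra.TensorProduct.map (AlgHom.id ℂ A) Algebra.TensorProduct.includeLeft

/-- `(A, Δ, ϵ, Φ)` is a quasi-bialgebra. The inverse of the invertible element `Φ` is
`Ring.inverse Φ`. -/
structure IsQuasiBialgebra (Δ : A →ₐ[ℂ] A ⊗[ℂ] A) (ϵ : A →ₐ[ℂ] ℂ)
    (Φ : A ⊗[ℂ] (A ⊗[ℂ] A)) : Prop where
  isUnit : IsUnit Φ
  counit_left : ∀ a, counitLeft ϵ (Δ a) = a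
  counit_right : ∀ a, counitRight ϵ (Δ a) = a
  quasi_coassoc : ∀ a,
    comulLeft Δ (Δ a) = Φ * comulRight Δ (Δ a) * Ring.inverse Φ
  counital : counitMiddle ϵ Φ = 1 ⊗ₜ[ℂ] 1
  cocycle : comul₁ Δ Φ * comul₃ Δ Φ = tensorOne Φ * comul₂ Δ Φ * oneTensor Φ

/-- `R` is a universal R-matrix for the quasi-bialgebra with comultiplication `Δ` and
coassociator `Φ`. -/
structure IsUniversalRMatrix (Δ : A →ₐ[ℂ] A ⊗[ℂ] A)
    (Φ : A ⊗[ℂ] (A ⊗[ℂ] A)) (R : A ⊗[ℂ] A) : Prop where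
  isUnit : IsUnit R
  intertwine : ∀ a, R * Δ a = Algebra.TensorProduct.comm ℂ A A (Δ a) * R
  hexagon_left : comulLeft Δ R =
    Ring.inverse (perm231 Φ) * emb13 R * perm132 Φ * emb23 R * Ring.inverse Φ
  hexagon_right : comulRight Δ R =
    perm312 Φ * emb13 R * Ring.inverse (perm213 Φ) * emb12 R * Φ

/-- `(A, Δ, Φ)` is quasi-triangular: it admits a universal R-matrix. -/
def IsQuasiTriangular (Δ : A →ₐ[ℂ] A ⊗[ℂ] A) (Φ : A ⊗[ℂ] (A ⊗[ℂ] A)) : Prop :=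
  ∃ R, IsUniversalRMatrix Δ Φ R

/-- `R` is a universal R-matrix for the (strictly coassociative) bialgebra with
comultiplication `Δ`. -/
structure IsBialgebraRMatrix (Δ : A →ₐ[ℂ] A ⊗[ℂ] A) (R : A ⊗[ℂ] A) : Prop where
  isUnit : IsUnit R
  intertwine : ∀ a, R * Δ a = Algebra.TensorProduct.comm ℂ A A (Δ a) * R
  hexagon_left : comulLeft Δ R = emb13 R * emb23 R
  hexagon_right : comulRight Δ R = emb13 R * emb12 R

end QB

/-! ### The restricted quantum group `Q` of `sl(2)` at `q = i` -/

namespace ResQ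

/-- The generators `E`, `F`, `K`, `K⁻¹`. -/
inductive Gen : Type
  | E | F | K | Kinv

open FreeAlgebra in
/-- The defining relations at `q = i`. -/
inductive Rel : FreeAlgebra ℂ Gen → FreeAlgebra ℂ Gen → Prop
  | K_Kinv : Rel (ι ℂ Gen.K * ι ℂ Gen.Kinv) 1
  | Kinv_K : Rel (ι ℂ Gen.Kinv * ι ℂ Gen.K) 1
  | K_E : Rel (ι ℂ Gen.K * ι ℂ Gen.E * ι ℂ Gen.Kinv) (-ι ℂ Gen.E)
  | K_F : Rel (ι ℂ Gen.K * ι ℂ Gen.F * ι ℂ Gen.Kinv) (-ι ℂ Gen.F)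
  | E_F : Rel (ι ℂ Gen.E * ι ℂ Gen.F - ι ℂ Gen.F * ι ℂ Gen.E)
      ((Complex.I - Complex.I⁻¹)⁻¹ • (ι ℂ Gen.K - ι ℂ Gen.Kinv))
  | E_sq : Rel (ι ℂ Gen.E ^ 2) 0
  | F_sq : Rel (ι ℂ Gen.F ^ 2) 0
  | K_pow : Rel (ι ℂ Gen.K ^ 4) 1

/-- The algebra `Q` generated by `E`, `F`, `K`, `K⁻¹` subject to the relations `Rel`. -/
def Q : Type := RingQuot Rel

instance instRingQ : Ring Q := inferInstanceAs (Ring (RingQuot Rel))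

instance instAlgebraQ : Algebra ℂ Q := inferInstanceAs (Algebra ℂ (RingQuot Rel))

/-- The quotient map from the free algebra. -/
def toQ : FreeAlgebra ℂ Gen →ₐ[ℂ] Q := RingQuot.mkAlgHom ℂ Rel

theorem toQ_rel {x y : FreeAlgebra ℂ Gen} (h : Rel x y) : toQ x = toQ y :=
  RingQuot.mkAlgHom_rel ℂ h

/-- The class of a generator in `Q`. -/
def gen (g : Gen) : Q := toQ (FreeAlgebra.ι ℂ g)

def E : Q := gen Gen.E
def F : Q := gen Gen.F
def K : Q := gen Gen.K
def Kinv : Q := gen Gen.Kinv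

/-- The images `e, f, k, k'` of the generators satisfy the defining relations. -/
structure Sat {B : Type} [Ring B] [Algebra ℂ B] (e f k k' : B) : Prop where
  k_k' : k * k' = 1
  k'_k : k' * k = 1
  k_e : k * e * k' = -e
  k_f : k * f * k' = -f
  e_f : e * f - f * e = (Complex.I - Complex.I⁻¹)⁻¹ • (k - k')
  e_sq : e ^ 2 = 0
  f_sq : f ^ 2 = 0
  k_pow : k ^ 4 = 1

theorem sat_gen : Sat E F K Kinv where
  k_k' := by
    have h := toQ_rel Rel.K_Kinv
    simp only [map_mul, map_one] at h
    exact h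
  k'_k := by
    have h := toQ_rel Rel.Kinv_K
    simp only [map_mul, map_one] at h
    exact h
  k_e := by
    have h := toQ_rel Rel.K_E
    simp only [map_mul, map_neg] at h
    exact h
  k_f := by
    have h := toQ_rel Rel.K_F
    simp only [map_mul, map_neg] at h
    exact h
  e_f := by
    have h := toQ_rel Rel.E_F
    simp only [map_mul, map_sub, map_smul] at h
    exact h
  e_sq := by
    have h := toQ_rel Rel.E_sq
    simp only [map_pow, map_zero] at h
    exact h
  f_sq := by
    have h := toQ_rel Rel.F_sq
    simp only [map_pow, map_zero] at h
    exact h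
  k_pow := by
    have h := toQ_rel Rel.K_pow
    simp only [map_pow, map_one] at h
    exact h

/-- A choice of images of the generators. -/
def genMap {B : Type} (e f k k' : B) : Gen → B
  | Gen.E => e
  | Gen.F => f
  | Gen.K => k
  | Gen.Kinv => k'

theorem lift_aux {B : Type} [Ring B] [Algebra ℂ B] {e f k k' : B} (h : Sat e f k k')
    ⦃x y : FreeAlgebra ℂ Gen⦄ (hxy : Rel x y) :
    FreeAlgebra.lift ℂ (genMap e f k k') x = FreeAlgebra.lift ℂ (genMap e f k k') y := by
  cases hxy <;> simp only [map_mul, map_sub, map_neg, map_pow, map_one, map_zero, map_smul,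
    FreeAlgebra.lift_ι_apply, genMap]
  exacts [h.k_k', h.k'_k, h.k_e, h.k_f, h.e_f, h.e_sq, h.f_sq, h.k_pow]

/-- The algebra homomorphism out of `Q` with prescribed images of the generators. -/
def lift {B : Type} [Ring B] [Algebra ℂ B] {e f k k' : B} (h : Sat e f k k') : Q →ₐ[ℂ] B :=
  RingQuot.liftAlgHom ℂ ⟨FreeAlgebra.lift ℂ (genMap e f k k'), lift_aux h⟩

section lift

variable {B : Type} [Ring B] [Algebra ℂ B] {e f k k' : B} (h : Sat e f k k')

theorem lift_gen (g : Gen) : lift h (gen g) = genMap e f k k' g := by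
  have := RingQuot.liftAlgHom_mkAlgHom_apply ℂ (FreeAlgebra.lift ℂ (genMap e f k k'))
    (lift_aux h) (FreeAlgebra.ι ℂ g)
  rw [FreeAlgebra.lift_ι_apply] at this
  exact this

@[simp] theorem lift_E : lift h E = e := lift_gen h _
@[simp] theorem lift_F : lift h F = f := lift_gen h _
@[simp] theorem lift_K : lift h K = k := lift_gen h _
@[simp] theorem lift_Kinv : lift h Kinv = k' := lift_gen h _

theorem hom_ext {φ ψ : Q →ₐ[ℂ] B} (hE : φ E = ψ E) (hF : φ F = ψ F) (hK : φ K = ψ K)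
    (hKinv : φ Kinv = ψ Kinv) : φ = ψ := by
  refine RingQuot.ringQuot_ext' ℂ φ ψ (FreeAlgebra.hom_ext (funext fun g => ?_))
  cases g
  exacts [hE, hF, hK, hKinv]

end lift

theorem K_mul_E : K * E = -(E * K) := by
  have h := congrArg (· * K) sat_gen.k_e
  simpa [mul_assoc, sat_gen.k'_k] using h

theorem K_mul_F : K * F = -(F * K) := by
  have h := congrArg (· * K) sat_gen.k_f
  simpa [mul_assoc, sat_gen.k'_k] using h

theorem Kinv_mul_E : Kinv * E = -(E * Kinv) := by
  have h := congrArg (Kinv * ·) sat_gen.k_e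
  simp only [← mul_assoc, sat_gen.k'_k, one_mul] at h
  simp [h]

theorem Kinv_mul_F : Kinv * F = -(F * Kinv) := by
  have h := congrArg (Kinv * ·) sat_gen.k_f
  simp only [← mul_assoc, sat_gen.k'_k, one_mul] at h
  simp [h]

theorem sat_comul : Sat (1 ⊗ₜ[ℂ] E + E ⊗ₜ[ℂ] K) (Kinv ⊗ₜ[ℂ] F + F ⊗ₜ[ℂ] 1)
    (K ⊗ₜ[ℂ] K) (Kinv ⊗ₜ[ℂ] Kinv) := by
  have hEE : E * E = 0 := by simpa [sq] using sat_gen.e_sq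
  have hFF : F * F = 0 := by simpa [sq] using sat_gen.f_sq
  have hEF : E * F = F * E + (Complex.I - Complex.I⁻¹)⁻¹ • (K - Kinv) := by
    rw [← sat_gen.e_f]; abel
  constructor
  · simp [sat_gen.k_k', Algebra.TensorProduct.one_def]
  · simp [sat_gen.k'_k, Algebra.TensorProduct.one_def]
  · simp [mul_add, add_mul, sat_gen.k_k', sat_gen.k_e, mul_assoc K K Kinv, TensorProduct.tmul_neg,
      TensorProduct.neg_tmul]
    abel
  · simp [mul_add, add_mul, sat_gen.k_k', sat_gen.k_f, TensorProduct.tmul_neg,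
      TensorProduct.neg_tmul]
    abel
  · simp only [mul_add, add_mul, Algebra.TensorProduct.tmul_mul_tmul, one_mul, mul_one,
      K_mul_F, Kinv_mul_E, hEF, TensorProduct.tmul_add, TensorProduct.add_tmul,
      TensorProduct.tmul_neg, TensorProduct.neg_tmul, TensorProduct.tmul_smul,
      TensorProduct.smul_tmul', TensorProduct.tmul_sub, TensorProduct.sub_tmul, smul_sub]
    abel
  · simp [sq, mul_add, add_mul, hEE, K_mul_E, TensorProduct.tmul_neg]
  · simp [sq, mul_add, add_mul, hFF, Kinv_mul_F, TensorProduct.neg_tmul]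
  · simp [Algebra.TensorProduct.tmul_pow, sat_gen.k_pow, Algebra.TensorProduct.one_def]

theorem sat_counit : Sat (0 : ℂ) 0 1 1 := by
  constructor <;> simp

/-- The comultiplication: `Δ E = 1 ⊗ E + E ⊗ K`, `Δ F = K⁻¹ ⊗ F + F ⊗ 1`, `Δ K = K ⊗ K`. -/
def comul : Q →ₐ[ℂ] Q ⊗[ℂ] Q := lift sat_comul

/-- The counit: `ϵ E = ϵ F = 0`, `ϵ K = 1`. -/
def counit : Q →ₐ[ℂ] ℂ := lift sat_counit

instance instBialgebraQ : Bialgebra ℂ Q :=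
  Bialgebra.ofAlgHom comul counit
    (by
      apply hom_ext <;>
        simp [comul, TensorProduct.tmul_add, TensorProduct.add_tmul,
          Algebra.TensorProduct.one_def, add_assoc])
    (by
      apply hom_ext <;>
        simp [comul, counit])
    (by
      apply hom_ext <;>
        simp [comul, counit])

/-- The central idempotents `e₀ = (1 + K²)/2` and `e₁ = (1 - K²)/2`. -/
def e (i : ZMod 2) : Q := if i = 0 then (2⁻¹ : ℂ) • (1 + K ^ 2) else (2⁻¹ : ℂ) • (1 - K ^ 2)

/-- `φ_ε(i,j,k)` equals `ε` if `i = j = k = 1`, and `1` otherwise. -/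
def phi (ε : ℂˣ) (i j k : ZMod 2) : ℂˣ := if i = 1 ∧ j = 1 ∧ k = 1 then ε else 1

/-- `ω` is a normalised `3`-cocycle of `ℤ/2` with values in `ℂˣ` (trivial action). -/
structure IsNormalisedThreeCocycle (ω : ZMod 2 → ZMod 2 → ZMod 2 → ℂˣ) : Prop where
  cocycle : ∀ i j k l,
    ω j k l * ω i (j + k) l * ω i j k = ω (i + j) k l * ω i j (k + l)
  normalised : ∀ i j k, i = 0 ∨ j = 0 ∨ k = 0 → ω i j k = 1

/-- `Φ_ε = ∑ φ_ε(i,j,k) e_i ⊗ e_j ⊗ e_k`. -/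
def Phi (ε : ℂˣ) : Q ⊗[ℂ] (Q ⊗[ℂ] Q) :=
  ∑ i : ZMod 2, ∑ j : ZMod 2, ∑ k : ZMod 2,
    (phi ε i j k : ℂ) • (e i ⊗ₜ[ℂ] (e j ⊗ₜ[ℂ] e k))

end ResQ

/-! ### The monoidal category of finite-dimensional modules over a bialgebra -/

/-- A finite-dimensional complex representation of the algebra `A`. -/
structure FinRep (A : Type) [Ring A] [Algebra ℂ A] where
  V : Type
  [addCommGroup : AddCommGroup V]
  [module : Module ℂ V]
  [finite : FiniteDimensional ℂ V]
  ρ : A →ₐ[ℂ] Module.End ℂ V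

namespace FinRep

attribute [instance] FinRep.addCommGroup FinRep.module FinRep.finite

section Category

variable {A : Type} [Ring A] [Algebra ℂ A]

/-- Intertwiners. -/
@[ext] structure Hom (X Y : FinRep A) where
  map : X.V →ₗ[ℂ] Y.V
  comm : ∀ a x, map (X.ρ a x) = Y.ρ a (map x)

instance : Category (FinRep A) where
  Hom X Y := Hom X Y
  id X := ⟨LinearMap.id, fun _ _ => rfl⟩
  comp f g := ⟨g.map ∘ₗ f.map, fun a x => by simp [f.comm, g.comm]⟩

@[ext] theorem hom_ext {X Y : FinRep A} {f g : X ⟶ Y} (h : f.map = g.map) : f = g :=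
  Hom.ext h

@[simp] theorem id_map (X : FinRep A) : (𝟙 X : X ⟶ X).map = LinearMap.id := rfl

@[simp] theorem comp_map {X Y Z : FinRep A} (f : X ⟶ Y) (g : Y ⟶ Z) :
    (f ≫ g).map = g.map ∘ₗ f.map := rfl

/-- A linear equivalence that intertwines the actions is an isomorphism. -/
def mkIso {X Y : FinRep A} (f : X.V ≃ₗ[ℂ] Y.V) (h : ∀ a x, f (X.ρ a x) = Y.ρ a (f x)) :
    X ≅ Y where
  hom := ⟨f.toLinearMap, h⟩
  inv := ⟨f.symm.toLinearMap, fun a y => by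
    apply f.injective
    simp [h]⟩
  hom_inv_id := by ext x; exact f.symm_apply_apply x
  inv_hom_id := by ext x; exact f.apply_symm_apply x

end Category

/-- The action of `A ⊗ B` on `V ⊗ W` for an `A`-module `V` and a `B`-module `W`. -/
def act {A B V W : Type} [Ring A] [Algebra ℂ A] [Ring B] [Algebra ℂ B] [AddCommGroup V]
    [Module ℂ V] [AddCommGroup W] [Module ℂ W] (ρ : A →ₐ[ℂ] Module.End ℂ V)
    (σ : B →ₐ[ℂ] Module.End ℂ W) : A ⊗[ℂ] B →ₐ[ℂ] Module.End ℂ (V ⊗[ℂ] W) :=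
  Module.endTensorEndAlgHom.comp (Algebra.TensorProduct.map ρ σ)

section act

variable {A B C V W U : Type} [Ring A] [Algebra ℂ A] [Ring B] [Algebra ℂ B] [Ring C]
  [Algebra ℂ C] [AddCommGroup V] [Module ℂ V] [AddCommGroup W] [Module ℂ W]
  [AddCommGroup U] [Module ℂ U] (ρ : A →ₐ[ℂ] Module.End ℂ V)
  (σ : B →ₐ[ℂ] Module.End ℂ W) (τ : C →ₐ[ℂ] Module.End ℂ U)

@[simp] theorem act_tmul (a : A) (b : B) (v : V) (w : W) :
    act ρ σ (a ⊗ₜ b) (v ⊗ₜ w) = ρ a v ⊗ₜ σ b w := by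
  simp [act, Module.endTensorEndAlgHom_apply]

theorem act_comp {A' B' : Type} [Ring A'] [Algebra ℂ A'] [Ring B'] [Algebra ℂ B']
    (f : A' →ₐ[ℂ] A) (g : B' →ₐ[ℂ] B) (t : A' ⊗[ℂ] B') :
    act (ρ.comp f) (σ.comp g) t = act ρ σ (Algebra.TensorProduct.map f g t) := by
  induction t with
  | zero => simp
  | add s t hs ht => simp only [map_add, hs, ht]
  | tmul a b =>
    apply TensorProduct.ext'
    intro v w
    simp

theorem assoc_act (u : (A ⊗[ℂ] B) ⊗[ℂ] C) (x : (V ⊗[ℂ] W) ⊗[ℂ] U) :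
    TensorProduct.assoc ℂ V W U (act (act ρ σ) τ u x) =
      act ρ (act σ τ) (Algebra.TensorProduct.assoc ℂ ℂ ℂ A B C u)
        (TensorProduct.assoc ℂ V W U x) := by
  refine LinearMap.congr_fun
    (f := (TensorProduct.assoc ℂ V W U).toLinearMap ∘ₗ act (act ρ σ) τ u)
    (g := act ρ (act σ τ) (Algebra.TensorProduct.assoc ℂ ℂ ℂ A B C u) ∘ₗ
      (TensorProduct.assoc ℂ V W U).toLinearMap) ?_ x
  induction u with
  | zero => simp
  | add s t hs ht => simp only [map_add, LinearMap.comp_add, LinearMap.add_comp, hs, ht]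
  | tmul t c =>
    induction t with
    | zero => simp
    | add s t hs ht =>
      simp only [TensorProduct.add_tmul, map_add, LinearMap.comp_add, LinearMap.add_comp, hs, ht]
    | tmul a b =>
      apply TensorProduct.ext_threefold
      intro x y z
      simp

theorem lid_act (ϵ : A →ₐ[ℂ] ℂ) (t : A ⊗[ℂ] B) (x : ℂ ⊗[ℂ] W) :
    TensorProduct.lid ℂ W (act ((Algebra.lmul ℂ ℂ).comp ϵ) σ t x) =
      σ (TensorProduct.lid ℂ B (LinearMap.rTensor B ϵ.toLinearMap t))
        (TensorProduct.lid ℂ W x) := by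
  refine LinearMap.congr_fun
    (f := (TensorProduct.lid ℂ W).toLinearMap ∘ₗ act ((Algebra.lmul ℂ ℂ).comp ϵ) σ t)
    (g := σ (TensorProduct.lid ℂ B (LinearMap.rTensor B ϵ.toLinearMap t)) ∘ₗ
      (TensorProduct.lid ℂ W).toLinearMap) ?_ x
  induction t with
  | zero => simp
  | add s t hs ht => simp only [map_add, LinearMap.comp_add, LinearMap.add_comp, hs, ht]
  | tmul b c =>
    apply TensorProduct.ext'
    intro z x
    simp [mul_smul]

theorem rid_act (ϵ : B →ₐ[ℂ] ℂ) (t : A ⊗[ℂ] B) (x : V ⊗[ℂ] ℂ) :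
    TensorProduct.rid ℂ V (act ρ ((Algebra.lmul ℂ ℂ).comp ϵ) t x) =
      ρ (TensorProduct.rid ℂ A (LinearMap.lTensor A ϵ.toLinearMap t))
        (TensorProduct.rid ℂ V x) := by
  refine LinearMap.congr_fun
    (f := (TensorProduct.rid ℂ V).toLinearMap ∘ₗ act ρ ((Algebra.lmul ℂ ℂ).comp ϵ) t)
    (g := ρ (TensorProduct.rid ℂ A (LinearMap.lTensor A ϵ.toLinearMap t)) ∘ₗ
      (TensorProduct.rid ℂ V).toLinearMap) ?_ x
  induction t with
  | zero => simp
  | add s t hs ht => simp only [map_add, LinearMap.comp_add, LinearMap.add_comp, hs, ht]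
  | tmul b c =>
    apply TensorProduct.ext'
    intro x z
    simp [mul_smul]

theorem map_act {V' W' : Type} [AddCommGroup V'] [Module ℂ V'] [AddCommGroup W'] [Module ℂ W']
    (ρ' : A →ₐ[ℂ] Module.End ℂ V') (σ' : B →ₐ[ℂ] Module.End ℂ W') (f : V →ₗ[ℂ] V')
    (g : W →ₗ[ℂ] W') (hf : ∀ a v, f (ρ a v) = ρ' a (f v)) (hg : ∀ b w, g (σ b w) = σ' b (g w))
    (t : A ⊗[ℂ] B) (x : V ⊗[ℂ] W) :
    TensorProduct.map f g (act ρ σ t x) = act ρ' σ' t (TensorProduct.map f g x) := by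
  refine LinearMap.congr_fun (f := TensorProduct.map f g ∘ₗ act ρ σ t)
    (g := act ρ' σ' t ∘ₗ TensorProduct.map f g) ?_ x
  induction t with
  | zero => simp
  | add s t hs ht => simp only [map_add, LinearMap.comp_add, LinearMap.add_comp, hs, ht]
  | tmul b c =>
    apply TensorProduct.ext'
    intro x y
    simp [hf, hg]

theorem triangle_act (v : V) (z : ℂ) (w : W) :
    v ⊗ₜ[ℂ] (z • w) = (z • v) ⊗ₜ[ℂ] w := (TensorProduct.smul_tmul z v w).symm

end act

section Monoidal

variable {A : Type} [Ring A] [Bialgebra ℂ A]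

/-- `U ⊗ V` over `ℂ`, on which `a` acts through `Δ a`. -/
def tensor (X Y : FinRep A) : FinRep A where
  V := X.V ⊗[ℂ] Y.V
  ρ := (act X.ρ Y.ρ).comp (Bialgebra.comulAlgHom ℂ A)

/-- The ground field, on which `A` acts through the counit. -/
def unit : FinRep A where
  V := ℂ
  ρ := (Algebra.lmul ℂ ℂ).comp (Bialgebra.counitAlgHom ℂ A)

theorem unit_ρ (a : A) (z : ℂ) :
    (unit : FinRep A).ρ a z = Coalgebra.counit (R := ℂ) a * z := rfl

theorem tensor_ρ (X Y : FinRep A) (a : A) :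
    (tensor X Y).ρ a = act X.ρ Y.ρ (Coalgebra.comul (R := ℂ) a) := rfl

/-- The tensor product of two intertwiners. -/
def tensorMap {X X' Y Y' : FinRep A} (f : X ⟶ X') (g : Y ⟶ Y') :
    tensor X Y ⟶ tensor X' Y' :=
  ⟨TensorProduct.map f.map g.map, fun a =>
    map_act X.ρ Y.ρ X'.ρ Y'.ρ f.map g.map f.comm g.comm (Coalgebra.comul (R := ℂ) a)⟩

theorem tensorMap_map {X X' Y Y' : FinRep A} (f : X ⟶ X') (g : Y ⟶ Y') :
    (tensorMap f g).map = TensorProduct.map f.map g.map := rfl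

theorem assoc_comm (X Y Z : FinRep A) (a : A) (x : (X.V ⊗[ℂ] Y.V) ⊗[ℂ] Z.V) :
    TensorProduct.assoc ℂ X.V Y.V Z.V ((tensor (tensor X Y) Z).ρ a x) =
      (tensor X (tensor Y Z)).ρ a (TensorProduct.assoc ℂ X.V Y.V Z.V x) := by
  have h1 := act_comp (act X.ρ Y.ρ) Z.ρ (Bialgebra.comulAlgHom ℂ A) (AlgHom.id ℂ A)
    (Coalgebra.comul (R := ℂ) a)
  have h2 := act_comp X.ρ (act Y.ρ Z.ρ) (AlgHom.id ℂ A) (Bialgebra.comulAlgHom ℂ A)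
    (Coalgebra.comul (R := ℂ) a)
  have h3 : Algebra.TensorProduct.assoc ℂ ℂ ℂ A A A
      (Algebra.TensorProduct.map (Bialgebra.comulAlgHom ℂ A) (AlgHom.id ℂ A)
          (Coalgebra.comul (R := ℂ) a)) =
      Algebra.TensorProduct.map (AlgHom.id ℂ A) (Bialgebra.comulAlgHom ℂ A)
          (Coalgebra.comul (R := ℂ) a) := Coalgebra.coassoc_apply a
  have h4 := assoc_act X.ρ Y.ρ Z.ρ (Algebra.TensorProduct.map (Bialgebra.comulAlgHom ℂ A)
    (AlgHom.id ℂ A) (Coalgebra.comul (R := ℂ) a)) x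
  rw [h3, ← h1, ← h2] at h4
  exact h4

theorem lid_comm (X : FinRep A) (a : A) (x : ℂ ⊗[ℂ] X.V) :
    TensorProduct.lid ℂ X.V ((tensor unit X).ρ a x) = X.ρ a (TensorProduct.lid ℂ X.V x) := by
  refine (lid_act X.ρ (Bialgebra.counitAlgHom ℂ A) (Coalgebra.comul (R := ℂ) a) x).trans ?_
  have h := Coalgebra.rTensor_counit_comul (R := ℂ) a
  change X.ρ (TensorProduct.lid ℂ A (LinearMap.rTensor A Coalgebra.counit
    (Coalgebra.comul (R := ℂ) a))) _ = _
  rw [h, TensorProduct.lid_tmul, one_smul]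

theorem rid_comm (X : FinRep A) (a : A) (x : X.V ⊗[ℂ] ℂ) :
    TensorProduct.rid ℂ X.V ((tensor X unit).ρ a x) = X.ρ a (TensorProduct.rid ℂ X.V x) := by
  refine (rid_act X.ρ (Bialgebra.counitAlgHom ℂ A) (Coalgebra.comul (R := ℂ) a) x).trans ?_
  have h := Coalgebra.lTensor_counit_comul (R := ℂ) a
  change X.ρ (TensorProduct.rid ℂ A (LinearMap.lTensor A Coalgebra.counit
    (Coalgebra.comul (R := ℂ) a))) _ = _
  rw [h, TensorProduct.rid_tmul, one_smul]

/-- The tensor category of finite-dimensional representations, with the associativity and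
unit isomorphisms of vector spaces. -/
instance instMonoidalStruct : MonoidalCategoryStruct (FinRep A) where
  tensorObj := tensor
  whiskerLeft X _ _ f := tensorMap (𝟙 X) f
  whiskerRight f Y := tensorMap f (𝟙 Y)
  tensorHom f g := tensorMap f g
  tensorUnit := unit
  associator X Y Z := mkIso (TensorProduct.assoc ℂ X.V Y.V Z.V) (assoc_comm X Y Z)
  leftUnitor X := mkIso (TensorProduct.lid ℂ X.V) (lid_comm X)
  rightUnitor X := mkIso (TensorProduct.rid ℂ X.V) (rid_comm X)

instance instMonoidal : MonoidalCategory (FinRep A) :=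
  MonoidalCategory.ofTensorHom
    (id_tensorHom_id := fun _ _ => hom_ext (TensorProduct.ext' fun _ _ => rfl))
    (id_tensorHom := fun _ _ _ _ => rfl)
    (tensorHom_id := fun _ _ => rfl)
    (tensorHom_comp_tensorHom := fun _ _ _ _ => hom_ext (TensorProduct.ext' fun _ _ => rfl))
    (associator_naturality := fun _ _ _ =>
      hom_ext (TensorProduct.ext_threefold fun _ _ _ => rfl))
    (leftUnitor_naturality := fun f =>
      hom_ext (TensorProduct.ext' fun z x => (f.map.map_smul z x).symm))
    (rightUnitor_naturality := fun f =>
      hom_ext (TensorProduct.ext' fun x z => (f.map.map_smul z x).symm))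
    (pentagon := fun _ _ _ _ =>
      hom_ext (TensorProduct.ext_fourfold fun _ _ _ _ => rfl))
    (triangle := fun _ _ =>
      hom_ext (TensorProduct.ext_threefold fun x z y =>
        triangle_act x z y))

end Monoidal

end FinRep

end

/-! The idempotents `e₀`, `e₁` are central and `Δ(e_k) = ∑_{i+j=k} e_i ⊗ e_j`, so for any function
`ω` on triples `Φ_ω = ∑ ω(i,j,k) e_i ⊗ e_j ⊗ e_k` is central and the quasi-bialgebra axioms for it
become scalar identities between values of `ω`: normalisation and the 3-cocycle identity.

The obstruction to a universal R-matrix comes from the character `sign : E, F ↦ 0, K ↦ -1`, whose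
convolution square is the counit and which sends each leg of `Φ_ε` to `1`. For these two reasons
`r = (sign ⊗ id)(R)` is a grouplike involution, and `R Δ = Δᵒᵖ R` makes it anticommute with `E` and
`F`. Let `T` be the action of `r` on the two-dimensional Steinberg representation, whose tensor
square contains an invariant vector `v ≠ 0`. Since `r` is grouplike, `(T ⊗ T) v = v`; but an
involution anticommuting with `E` and `F` acts by opposite signs on the two weight vectors, whence
`(T ⊗ T) v = -v`. For a braiding, take for `T` the braiding of the one-dimensional representation
`sign` with the Steinberg representation: the hexagons and naturality replace grouplikeness.
-/

namespace QB

section Idempotents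

variable {R A B ι κ : Type*} [CommSemiring R] [Semiring A] [Algebra R A] [Semiring B] [Algebra R B]
  [Fintype ι] [Fintype κ] {p : ι → A} {q : κ → B}

theorem eq_of_forall_mul_idem_eq (hp : CompleteOrthogonalIdempotents p) {x y : A}
    (h : ∀ i, x * p i = y * p i) : x = y := by
  rw [← mul_one x, ← mul_one y, ← hp.complete, Finset.mul_sum, Finset.mul_sum]
  exact Finset.sum_congr rfl fun i _ => h i

theorem sum_smul_mul_idem (hp : OrthogonalIdempotents p) (c : ι → R) (j : ι) :
    (∑ i, c i • p i) * p j = c j • p j := by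
  classical
  simp only [Finset.sum_mul, smul_mul_assoc, hp.mul_eq, smul_ite, smul_zero,
    Finset.sum_ite_eq', Finset.mem_univ, if_true]

theorem completeOrthogonalIdempotents_tmul (hp : CompleteOrthogonalIdempotents p)
    (hq : CompleteOrthogonalIdempotents q) :
    CompleteOrthogonalIdempotents fun i : ι × κ => p i.1 ⊗ₜ[R] q i.2 where
  idem i := by
    rw [IsIdempotentElem, Algebra.TensorProduct.tmul_mul_tmul, hp.idem i.1, hq.idem i.2]
  ortho i j hij := by
    simp only [Algebra.TensorProduct.tmul_mul_tmul]
    by_cases h : i.1 = j.1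
    · rw [hq.ortho fun h' => hij (Prod.ext h h'), TensorProduct.tmul_zero]
    · rw [hp.ortho h, TensorProduct.zero_tmul]
  complete := by
    simp only [Fintype.sum_prod_type, ← TensorProduct.tmul_sum, ← TensorProduct.sum_tmul,
      hp.complete, hq.complete, Algebra.TensorProduct.one_def]

theorem mul_mul_eq_smul {x y r : A} {c d : R} (hx : x * r = c • r) (hy : y * r = d • r) :
    x * y * r = (c * d) • r := by
  rw [mul_assoc, hy, mul_smul_comm, hx, smul_smul, mul_comm]

theorem map_mul_eq_smul (f : A →ₐ[R] B) {x s : A} {r : B} {c : R} (hx : x * s = c • s)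
    (hr : f s * r = r) : f x * r = c • r := by
  rw [← hr, ← mul_assoc, ← map_mul, hx, map_smul, smul_mul_assoc]

theorem commute_tmul_of_commute {a : A} {b : B} (ha : ∀ x, Commute a x) (hb : ∀ y, Commute b y)
    (t : A ⊗[R] B) : Commute (a ⊗ₜ[R] b) t := by
  induction t with
  | zero => exact Commute.zero_right _
  | add s t hs ht => exact hs.add_right ht
  | tmul x y => exact (ha x).tmul (hb y)

end Idempotents

section Associator

variable {A G : Type} [Ring A] [Algebra ℂ A] [Fintype G]

/-- The element `∑ ω(i,j,k) eᵢ ⊗ eⱼ ⊗ eₖ` of the triple tensor product, a candidate coassociator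
when `ω` is a `3`-cocycle. -/
noncomputable def associator (e : G → A) (ω : G → G → G → ℂˣ) : A ⊗[ℂ] (A ⊗[ℂ] A) :=
  ∑ i, ∑ j, ∑ k, (ω i j k : ℂ) • (e i ⊗ₜ[ℂ] (e j ⊗ₜ[ℂ] e k))

variable {e : G → A}

theorem associator_mul_tmul (he : CompleteOrthogonalIdempotents e) (ω : G → G → G → ℂˣ)
    (i j k : G) : associator e ω * (e i ⊗ₜ[ℂ] (e j ⊗ₜ[ℂ] e k)) =
      (ω i j k : ℂ) • (e i ⊗ₜ[ℂ] (e j ⊗ₜ[ℂ] e k)) := by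
  have h := sum_smul_mul_idem (completeOrthogonalIdempotents_tmul (R := ℂ) he
    (completeOrthogonalIdempotents_tmul (R := ℂ) he he)).toOrthogonalIdempotents
    (fun t => (ω t.1 t.2.1 t.2.2 : ℂ)) (i, j, k)
  simpa only [associator, Fintype.sum_prod_type] using h

theorem associator_eq_of_mul_tmul (he : CompleteOrthogonalIdempotents e) {ω : G → G → G → ℂˣ}
    {x : A ⊗[ℂ] (A ⊗[ℂ] A)}
    (hx : ∀ i j k, x * (e i ⊗ₜ[ℂ] (e j ⊗ₜ[ℂ] e k)) =
      (ω i j k : ℂ) • (e i ⊗ₜ[ℂ] (e j ⊗ₜ[ℂ] e k))) : associator e ω = x :=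
  eq_of_forall_mul_idem_eq (completeOrthogonalIdempotents_tmul (R := ℂ) he
    (completeOrthogonalIdempotents_tmul (R := ℂ) he he)) fun t => by
      rw [associator_mul_tmul he, hx]

theorem associator_one (he : CompleteOrthogonalIdempotents e) : associator e 1 = 1 :=
  associator_eq_of_mul_tmul he fun i j k => by
    rw [one_mul, Pi.one_apply, Pi.one_apply, Pi.one_apply, Units.val_one, one_smul]

theorem associator_mul (he : CompleteOrthogonalIdempotents e) (ω ω' : G → G → G → ℂˣ) :
    associator e (ω * ω') = associator e ω * associator e ω' :=
  associator_eq_of_mul_tmul he fun i j k =>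
    mul_mul_eq_smul (associator_mul_tmul he ω i j k) (associator_mul_tmul he ω' i j k)

theorem isUnit_associator (he : CompleteOrthogonalIdempotents e) (ω : G → G → G → ℂˣ) :
    IsUnit (associator e ω) :=
  isUnit_iff_exists.mpr ⟨associator e ω⁻¹,
    by rw [← associator_mul he, mul_inv_cancel, associator_one he],
    by rw [← associator_mul he, inv_mul_cancel, associator_one he]⟩

theorem commute_associator (he : ∀ i a, Commute (e i) a) (ω : G → G → G → ℂˣ)
    (t : A ⊗[ℂ] (A ⊗[ℂ] A)) : Commute (associator e ω) t := by
  have h_tmul (i j k : G) : Commute (e i ⊗ₜ[ℂ] (e j ⊗ₜ[ℂ] e k)) t :=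
    commute_tmul_of_commute (he i) (commute_tmul_of_commute (he j) (he k)) t
  exact Commute.sum_left _ _ _ fun i _ => Commute.sum_left _ _ _ fun j _ =>
    Commute.sum_left _ _ _ fun k _ => (h_tmul i j k).smul_left _

end Associator

section Slices

variable {A : Type} [Ring A] [Algebra ℂ A]

@[simp] theorem counitLeft_tmul (χ : A →ₐ[ℂ] ℂ) (a b : A) :
    counitLeft χ (a ⊗ₜ b) = χ a • b := by simp [counitLeft]

@[simp] theorem counitRight_tmul (χ : A →ₐ[ℂ] ℂ) (a b : A) :
    counitRight χ (a ⊗ₜ b) = χ b • a := by simp [counitRight]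

/-- `χ ⊗ id ⊗ id : A ⊗ A ⊗ A → A ⊗ A`, the first of the three slice maps of a character; the second
one is `counitMiddle`. -/
noncomputable def counitFirst (χ : A →ₐ[ℂ] ℂ) : A ⊗[ℂ] (A ⊗[ℂ] A) →ₐ[ℂ] A ⊗[ℂ] A :=
  (Algebra.TensorProduct.lid ℂ (A ⊗[ℂ] A)).toAlgHom.comp
    (Algebra.TensorProduct.map χ (AlgHom.id ℂ (A ⊗[ℂ] A)))

/-- `id ⊗ id ⊗ χ : A ⊗ A ⊗ A → A ⊗ A`, the last of the three slice maps of a character. -/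
noncomputable def counitLast (χ : A →ₐ[ℂ] ℂ) : A ⊗[ℂ] (A ⊗[ℂ] A) →ₐ[ℂ] A ⊗[ℂ] A :=
  Algebra.TensorProduct.map (AlgHom.id ℂ A) (counitRight χ)

@[simp] theorem counitFirst_tmul (χ : A →ₐ[ℂ] ℂ) (a : A) (t : A ⊗[ℂ] A) :
    counitFirst χ (a ⊗ₜ t) = χ a • t := by simp [counitFirst]

@[simp] theorem counitMiddle_tmul (χ : A →ₐ[ℂ] ℂ) (a b c : A) :
    counitMiddle χ (a ⊗ₜ (b ⊗ₜ c)) = χ b • (a ⊗ₜ c) := by simp [counitMiddle]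

@[simp] theorem counitLast_tmul (χ : A →ₐ[ℂ] ℂ) (a b c : A) :
    counitLast χ (a ⊗ₜ (b ⊗ₜ c)) = χ c • (a ⊗ₜ b) := by simp [counitLast]

/-- The one-dimensional module `χ` associates strictly with all modules over a quasi-bialgebra with
coassociator `Φ`: applying `χ` to any one leg of `Φ` gives the unit. -/
structure AssociatesStrictly (χ : A →ₐ[ℂ] ℂ) (Φ : A ⊗[ℂ] (A ⊗[ℂ] A)) : Prop where
  first : counitFirst χ Φ = 1
  middle : counitMiddle χ Φ = 1
  last : counitLast χ Φ = 1

variable {G : Type} [Fintype G] {e : G → A} {ω : G → G → G → ℂˣ} {χ : A →ₐ[ℂ] ℂ}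

theorem map_associator_eq_one (he : CompleteOrthogonalIdempotents e)
    {f : A ⊗[ℂ] (A ⊗[ℂ] A) →ₐ[ℂ] A ⊗[ℂ] A}
    (hf : ∀ j k, ∃ a b c, ω a b c = 1 ∧
      f (e a ⊗ₜ (e b ⊗ₜ e c)) * (e j ⊗ₜ e k) = e j ⊗ₜ e k) : f (associator e ω) = 1 := by
  refine eq_of_forall_mul_idem_eq (completeOrthogonalIdempotents_tmul (R := ℂ) he he)
    fun ⟨j, k⟩ => ?_
  obtain ⟨a, b, c, hω, h⟩ := hf j k
  rw [map_mul_eq_smul f (associator_mul_tmul he ω a b c) h, hω, Units.val_one, one_smul, one_mul]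

variable [Zero G]

theorem counitMiddle_associator (he : CompleteOrthogonalIdempotents e)
    (hω : ∀ i k, ω i 0 k = 1) (hχ : χ (e 0) = 1) : counitMiddle χ (associator e ω) = 1 :=
  map_associator_eq_one he fun j k => ⟨j, 0, k, hω j k, by
    rw [counitMiddle_tmul, hχ, one_smul, Algebra.TensorProduct.tmul_mul_tmul, he.idem j,
      he.idem k]⟩

theorem associatesStrictly_associator (he : CompleteOrthogonalIdempotents e)
    (hω : ∀ i j k, i = 0 ∨ j = 0 ∨ k = 0 → ω i j k = 1) (hχ : χ (e 0) = 1) :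
    AssociatesStrictly χ (associator e ω) where
  first := map_associator_eq_one he fun j k => ⟨0, j, k, hω _ _ _ (.inl rfl), by
    rw [counitFirst_tmul, hχ, one_smul, Algebra.TensorProduct.tmul_mul_tmul, he.idem j,
      he.idem k]⟩
  middle := counitMiddle_associator he (fun _ _ => hω _ _ _ (.inr (.inl rfl))) hχ
  last := map_associator_eq_one he fun j k => ⟨j, k, 0, hω _ _ _ (.inr (.inr rfl)), by
    rw [counitLast_tmul, hχ, one_smul, Algebra.TensorProduct.tmul_mul_tmul, he.idem j,
      he.idem k]⟩

end Slices

section CentralGrading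

/-- A family of central idempotents decomposing `1` and indexed by a monoid `G`, compatible with the
bialgebra structure: `Δ eₖ` acts as the identity on `eᵢ ⊗ eⱼ` whenever `i + j = k`, so that the
tensor product of a module of degree `i` with one of degree `j` has degree `i + j`. -/
structure IsCentralGrading {A G : Type} [Ring A] [Bialgebra ℂ A] [Fintype G] [AddMonoid G]
    (e : G → A) : Prop extends CompleteOrthogonalIdempotents e where
  commute : ∀ i a, Commute (e i) a
  comul_mul : ∀ i j, Coalgebra.comul (R := ℂ) (e (i + j)) * (e i ⊗ₜ[ℂ] e j) = e i ⊗ₜ[ℂ] e j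
  counit_zero : Coalgebra.counit (R := ℂ) (e 0) = 1

variable {A G : Type} [Ring A] [Bialgebra ℂ A]

theorem counitLeft_comul (a : A) :
    counitLeft (Bialgebra.counitAlgHom ℂ A) (Bialgebra.comulAlgHom ℂ A a) = a :=
  (congrArg (TensorProduct.lid ℂ A) (Coalgebra.rTensor_counit_comul a)).trans (one_smul ℂ a)

theorem counitRight_comul (a : A) :
    counitRight (Bialgebra.counitAlgHom ℂ A) (Bialgebra.comulAlgHom ℂ A a) = a :=
  (congrArg (TensorProduct.rid ℂ A) (Coalgebra.lTensor_counit_comul a)).trans (one_smul ℂ a)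

theorem comulLeft_comul (a : A) :
    comulLeft (Bialgebra.comulAlgHom ℂ A) (Bialgebra.comulAlgHom ℂ A a) =
      comulRight (Bialgebra.comulAlgHom ℂ A) (Bialgebra.comulAlgHom ℂ A a) :=
  Coalgebra.coassoc_apply a

variable [Fintype G] [AddMonoid G] {e : G → A}

theorem IsCentralGrading.assoc_comul_tmul_mul {C : Type} [Ring C] [Algebra ℂ C]
    (he : IsCentralGrading e) (i j : G) {t : C} (ht : IsIdempotentElem t) :
    Algebra.TensorProduct.assoc ℂ ℂ ℂ A A C (Bialgebra.comulAlgHom ℂ A (e (i + j)) ⊗ₜ t) *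
      (e i ⊗ₜ (e j ⊗ₜ t)) = e i ⊗ₜ (e j ⊗ₜ t) := by
  have h : (Bialgebra.comulAlgHom ℂ A (e (i + j)) ⊗ₜ[ℂ] t) * ((e i ⊗ₜ[ℂ] e j) ⊗ₜ[ℂ] t) =
      (e i ⊗ₜ[ℂ] e j) ⊗ₜ[ℂ] t := by
    rw [Algebra.TensorProduct.tmul_mul_tmul, ht, Bialgebra.comulAlgHom_apply, he.comul_mul]
  exact (map_mul _ _ _).symm.trans (congrArg (Algebra.TensorProduct.assoc ℂ ℂ ℂ A A C) h)

theorem IsCentralGrading.comul₁_mul (he : IsCentralGrading e) (i j k l : G) :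
    comul₁ (Bialgebra.comulAlgHom ℂ A) (e (i + j) ⊗ₜ (e k ⊗ₜ e l)) *
      (e i ⊗ₜ (e j ⊗ₜ (e k ⊗ₜ e l))) = e i ⊗ₜ (e j ⊗ₜ (e k ⊗ₜ e l)) :=
  he.assoc_comul_tmul_mul i j
    ((completeOrthogonalIdempotents_tmul (R := ℂ) he.1 he.1).idem (k, l))

theorem IsCentralGrading.comul₂_mul (he : IsCentralGrading e) (i j k l : G) :
    comul₂ (Bialgebra.comulAlgHom ℂ A) (e i ⊗ₜ (e (j + k) ⊗ₜ e l)) *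
      (e i ⊗ₜ (e j ⊗ₜ (e k ⊗ₜ e l))) = e i ⊗ₜ (e j ⊗ₜ (e k ⊗ₜ e l)) := by
  rw [comul₂, Algebra.TensorProduct.map_tmul, Algebra.TensorProduct.tmul_mul_tmul,
    AlgHom.id_apply, he.idem i]
  exact congrArg _ (he.assoc_comul_tmul_mul j k (he.idem l))

theorem IsCentralGrading.comul₃_mul (he : IsCentralGrading e) (i j k l : G) :
    comul₃ (Bialgebra.comulAlgHom ℂ A) (e i ⊗ₜ (e j ⊗ₜ e (k + l))) *
      (e i ⊗ₜ (e j ⊗ₜ (e k ⊗ₜ e l))) = e i ⊗ₜ (e j ⊗ₜ (e k ⊗ₜ e l)) := by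
  simp only [comul₃, comulRight, Algebra.TensorProduct.map_tmul, AlgHom.id_apply,
    Algebra.TensorProduct.tmul_mul_tmul, (he.idem _).eq, Bialgebra.comulAlgHom_apply, he.comul_mul]

theorem IsCentralGrading.cocycle_associator (he : IsCentralGrading e) {ω : G → G → G → ℂˣ}
    (hω : ∀ i j k l, ω j k l * ω i (j + k) l * ω i j k = ω (i + j) k l * ω i j (k + l)) :
    comul₁ (Bialgebra.comulAlgHom ℂ A) (associator e ω) *
        comul₃ (Bialgebra.comulAlgHom ℂ A) (associator e ω) =
      tensorOne (associator e ω) * comul₂ (Bialgebra.comulAlgHom ℂ A) (associator e ω) *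
        oneTensor (associator e ω) := by
  refine eq_of_forall_mul_idem_eq (completeOrthogonalIdempotents_tmul (R := ℂ) he.1
    (completeOrthogonalIdempotents_tmul (R := ℂ) he.1
      (completeOrthogonalIdempotents_tmul (R := ℂ) he.1 he.1))) fun ⟨i, j, k, l⟩ => ?_
  have h₁ := map_mul_eq_smul _ (associator_mul_tmul he.1 ω (i + j) k l) (he.comul₁_mul i j k l)
  have h₂ := map_mul_eq_smul _ (associator_mul_tmul he.1 ω i (j + k) l) (he.comul₂_mul i j k l)
  have h₃ := map_mul_eq_smul _ (associator_mul_tmul he.1 ω i j (k + l)) (he.comul₃_mul i j k l)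
  have h_tensorOne := map_mul_eq_smul tensorOne (associator_mul_tmul he.1 ω i j k)
    (r := e i ⊗ₜ[ℂ] (e j ⊗ₜ[ℂ] (e k ⊗ₜ[ℂ] e l))) (by simp [tensorOne, (he.idem _).eq])
  have h_oneTensor := map_mul_eq_smul oneTensor (associator_mul_tmul he.1 ω j k l)
    (r := e i ⊗ₜ[ℂ] (e j ⊗ₜ[ℂ] (e k ⊗ₜ[ℂ] e l))) (by simp [oneTensor, (he.idem _).eq])
  rw [mul_mul_eq_smul h₁ h₃, mul_mul_eq_smul (mul_mul_eq_smul h_tensorOne h₂) h_oneTensor]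
  have h_cocycle : ω (i + j) k l * ω i j (k + l) = ω i j k * ω i (j + k) l * ω j k l := by
    rw [← hω]
    ac_rfl
  simp only [← Units.val_mul, h_cocycle]

theorem IsCentralGrading.isQuasiBialgebra_associator (he : IsCentralGrading e)
    {ω : G → G → G → ℂˣ}
    (hω : ∀ i j k l, ω j k l * ω i (j + k) l * ω i j k = ω (i + j) k l * ω i j (k + l))
    (hω_one : ∀ i k, ω i 0 k = 1) :
    IsQuasiBialgebra (Bialgebra.comulAlgHom ℂ A) (Bialgebra.counitAlgHom ℂ A)
      (associator e ω) where
  isUnit := isUnit_associator he.1 ω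
  counit_left := counitLeft_comul
  counit_right := counitRight_comul
  quasi_coassoc a := by
    rw [comulLeft_comul, (commute_associator he.commute ω _).eq, mul_assoc,
      Ring.mul_inverse_cancel _ (isUnit_associator he.1 ω), mul_one]
  counital := counitMiddle_associator he.1 hω_one he.counit_zero
  cocycle := he.cocycle_associator hω

end CentralGrading

end QB

namespace ResQ

@[elab_as_elim]
theorem gen_induction {P : Q → Prop} (algebraMap : ∀ c, P (algebraMap ℂ Q c))
    (gen : ∀ g, P (gen g)) (mul : ∀ a b, P a → P b → P (a * b))
    (add : ∀ a b, P a → P b → P (a + b)) (a : Q) : P a := by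
  obtain ⟨x, rfl⟩ := RingQuot.mkAlgHom_surjective ℂ Rel a
  change P (toQ x)
  induction x using FreeAlgebra.induction with
  | grade0 c => rw [AlgHom.commutes]; exact algebraMap c
  | grade1 g => exact gen g
  | mul x y hx hy => rw [map_mul]; exact mul _ _ hx hy
  | add x y hx hy => rw [map_add]; exact add _ _ hx hy

theorem commute_of_commute_gen {z : Q} (h : ∀ g, Commute z (gen g)) (a : Q) : Commute z a := by
  induction a using gen_induction with
  | algebraMap c => exact Algebra.commute_algebraMap_right c z
  | gen g => exact h g
  | mul a b ha hb => exact ha.mul_right hb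
  | add a b ha hb => exact ha.add_right hb

theorem commute_sq_of_anticommute {A : Type*} [Ring A] {x y : A} (h : x * y = -(y * x)) :
    Commute (x ^ 2) y := by
  rw [commute_iff_eq, sq, mul_assoc, h, mul_neg, ← mul_assoc, h, neg_mul, neg_neg, mul_assoc]

theorem commute_K_sq (a : Q) : Commute (K ^ 2) a :=
  commute_of_commute_gen
    (fun
      | .E => commute_sq_of_anticommute K_mul_E
      | .F => commute_sq_of_anticommute K_mul_F
      | .K => (Commute.refl K).pow_left 2
      | .Kinv => Commute.pow_left (sat_gen.k_k'.trans sat_gen.k'_k.symm) 2) a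

theorem e_zero : e 0 = (2⁻¹ : ℂ) • (1 + K ^ 2) := if_pos rfl

theorem e_one : e 1 = (2⁻¹ : ℂ) • (1 - K ^ 2) := if_neg one_ne_zero

theorem commute_e (i : ZMod 2) (a : Q) : Commute (e i) a := by
  fin_cases i
  · exact ((Commute.one_left a).add_left (commute_K_sq a)).smul_left _
  · exact ((Commute.one_left a).sub_left (commute_K_sq a)).smul_left _

theorem K_sq_mul_K_sq : K ^ 2 * K ^ 2 = 1 := by
  rw [← pow_add, sat_gen.k_pow]

theorem K_sq_mul_e_zero : K ^ 2 * e 0 = e 0 := by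
  rw [e_zero, mul_smul_comm, mul_add, K_sq_mul_K_sq, mul_one, add_comm]

theorem K_sq_mul_e_one : K ^ 2 * e 1 = -e 1 := by
  rw [e_one, mul_smul_comm, mul_sub, K_sq_mul_K_sq, mul_one, ← smul_neg, neg_sub]

theorem isIdempotentElem_e_zero : IsIdempotentElem (e 0) := by
  nth_rw 1 [IsIdempotentElem, e_zero]
  rw [smul_mul_assoc, add_mul, one_mul, K_sq_mul_e_zero]
  module

theorem e_one_eq : e 1 = 1 - e 0 := by
  rw [e_one, e_zero]
  module

theorem completeOrthogonalIdempotents_e : CompleteOrthogonalIdempotents e := by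
  have h : e = ![e 0, 1 - e 0] := by
    funext i
    fin_cases i
    exacts [rfl, e_one_eq]
  rw [h]
  exact .of_isIdempotentElem isIdempotentElem_e_zero

theorem comul_E : comul E = 1 ⊗ₜ E + E ⊗ₜ K := lift_E _
theorem comul_F : comul F = Kinv ⊗ₜ F + F ⊗ₜ 1 := lift_F _
theorem comul_K : comul K = K ⊗ₜ K := lift_K _
theorem counit_E : counit E = 0 := lift_E _
theorem counit_F : counit F = 0 := lift_F _
theorem counit_K : counit K = 1 := lift_K _

theorem comul_e_mul_tmul (i j : ZMod 2) :
    comul (e (i + j)) * (e i ⊗ₜ e j) = e i ⊗ₜ e j := by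
  have h_zero : comul (e 0) = (2⁻¹ : ℂ) • (1 + (K ^ 2) ⊗ₜ (K ^ 2)) := by
    rw [e_zero, map_smul, map_add, map_one, map_pow, comul_K, Algebra.TensorProduct.tmul_pow]
  have h_one : comul (e 1) = (2⁻¹ : ℂ) • (1 - (K ^ 2) ⊗ₜ (K ^ 2)) := by
    rw [e_one, map_smul, map_sub, map_one, map_pow, comul_K, Algebra.TensorProduct.tmul_pow]
  obtain ⟨rfl | rfl, rfl | rfl⟩ : (i = 0 ∨ i = 1) ∧ (j = 0 ∨ j = 1) := by revert i j; decide
  all_goals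
    simp only [add_zero, zero_add, CharTwo.add_self_eq_zero, h_zero, h_one, smul_mul_assoc, add_mul,
      sub_mul, one_mul, Algebra.TensorProduct.tmul_mul_tmul, K_sq_mul_e_zero, K_sq_mul_e_one,
      TensorProduct.neg_tmul, TensorProduct.tmul_neg]
    module

theorem isCentralGrading_e : QB.IsCentralGrading e where
  toCompleteOrthogonalIdempotents := completeOrthogonalIdempotents_e
  commute := commute_e
  comul_mul := comul_e_mul_tmul
  counit_zero := by
    change counit (e 0) = 1
    rw [e_zero, map_smul, map_add, map_one, map_pow, counit_K]
    norm_num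

theorem phi_of_eq_zero (ε : ℂˣ) : ∀ i j k, i = 0 ∨ j = 0 ∨ k = 0 → phi ε i j k = 1 := by
  rintro i j k (rfl | rfl | rfl) <;> simp [phi]

theorem phi_isNormalisedThreeCocycle {ε : ℂˣ} (hε : ε * ε = 1) :
    IsNormalisedThreeCocycle (phi ε) where
  cocycle i j k l := by
    have h : ∀ i : ZMod 2, i = 0 ∨ i = 1 := by decide
    rcases h i with rfl | rfl <;> rcases h j with rfl | rfl <;> rcases h k with rfl | rfl <;>
      rcases h l with rfl | rfl <;> simp [phi, hε, CharTwo.add_self_eq_zero]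
  normalised := phi_of_eq_zero ε

theorem isQuasiBialgebra_Phi {ε : ℂˣ} (hε : ε * ε = 1) :
    QB.IsQuasiBialgebra comul counit (Phi ε) :=
  isCentralGrading_e.isQuasiBialgebra_associator (phi_isNormalisedThreeCocycle hε).cocycle
    fun _ _ => phi_of_eq_zero ε _ _ _ (.inr (.inl rfl))

theorem Phi_eq (ε : ℂˣ) : Phi ε = 1 ⊗ₜ[ℂ] (1 ⊗ₜ[ℂ] 1) +
    ((ε : ℂ) - 1) • (e 1 ⊗ₜ[ℂ] (e 1 ⊗ₜ[ℂ] e 1)) := by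
  refine QB.associator_eq_of_mul_tmul completeOrthogonalIdempotents_e fun i j k => ?_
  have he := completeOrthogonalIdempotents_e
  simp only [← Algebra.TensorProduct.one_def, add_mul, one_mul, smul_mul_assoc,
    Algebra.TensorProduct.tmul_mul_tmul, he.mul_eq, phi]
  obtain rfl | hi := eq_or_ne i 1 <;> obtain rfl | hj := eq_or_ne j 1 <;>
    obtain rfl | hk := eq_or_ne k 1
  · simp only [and_self, if_true]
    module
  all_goals simp [*, Ne.symm]

theorem Phi_one : Phi 1 = 1 := by
  simp [Phi_eq, Algebra.TensorProduct.one_def]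

theorem isUnit_Phi (ε : ℂˣ) : IsUnit (Phi ε) :=
  QB.isUnit_associator completeOrthogonalIdempotents_e (phi ε)

theorem associatesStrictly_Phi {χ : Q →ₐ[ℂ] ℂ} (hχ : χ (e 0) = 1) (ε : ℂˣ) :
    QB.AssociatesStrictly χ (Phi ε) :=
  QB.associatesStrictly_associator completeOrthogonalIdempotents_e (phi_of_eq_zero ε) hχ

end ResQ

namespace QB

section CharacterSlices

variable {A : Type} [Ring A] [Algebra ℂ A]

/-- The convolution product `a ↦ ∑ χ(a₁) ψ(a₂)` of two characters, i.e. the tensor product of the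
corresponding one-dimensional modules. -/
noncomputable def charMul (Δ : A →ₐ[ℂ] A ⊗[ℂ] A) (χ ψ : A →ₐ[ℂ] ℂ) : A →ₐ[ℂ] ℂ :=
  ψ.comp ((counitLeft χ).comp Δ)

variable (Δ : A →ₐ[ℂ] A ⊗[ℂ] A) (χ ψ : A →ₐ[ℂ] ℂ)

theorem counitLeft_comm (t : A ⊗[ℂ] A) :
    counitLeft χ (Algebra.TensorProduct.comm ℂ A A t) = counitRight χ t := by
  induction t with
  | zero => simp only [map_zero]
  | add s t hs ht => simp only [map_add, hs, ht]
  | tmul a b => simp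

theorem counitFirst_perm132 (x : A ⊗[ℂ] (A ⊗[ℂ] A)) :
    counitFirst χ (perm132 x) = Algebra.TensorProduct.comm ℂ A A (counitFirst χ x) := by
  refine DFunLike.congr_fun (f := (counitFirst χ).comp perm132)
    (g := (Algebra.TensorProduct.comm ℂ A A).toAlgHom.comp (counitFirst χ)) ?_ x
  ext <;> simp [perm132, Algebra.TensorProduct.one_def]

theorem counitFirst_perm213 (x : A ⊗[ℂ] (A ⊗[ℂ] A)) :
    counitFirst χ (perm213 x) = counitMiddle χ x := by
  refine DFunLike.congr_fun (f := (counitFirst χ).comp perm213) (g := counitMiddle χ) ?_ x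
  ext <;> simp [perm213, Algebra.TensorProduct.one_def]

theorem counitMiddle_perm132 (x : A ⊗[ℂ] (A ⊗[ℂ] A)) :
    counitMiddle χ (perm132 x) = counitLast χ x := by
  refine DFunLike.congr_fun (f := (counitMiddle χ).comp perm132) (g := counitLast χ) ?_ x
  ext <;> simp [perm132, Algebra.TensorProduct.one_def]

theorem counitFirst_emb23 (R : A ⊗[ℂ] A) : counitFirst χ (emb23 R) = R := by
  simp [emb23]

theorem counitFirst_emb13 (R : A ⊗[ℂ] A) :
    counitFirst χ (emb13 R) = 1 ⊗ₜ counitLeft χ R := by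
  induction R with
  | zero => simp
  | add s t hs ht => simp only [map_add, hs, ht, TensorProduct.tmul_add]
  | tmul a b => simp [emb13]

theorem counitFirst_emb12 (R : A ⊗[ℂ] A) :
    counitFirst χ (emb12 R) = counitLeft χ R ⊗ₜ 1 := by
  induction R with
  | zero => simp
  | add s t hs ht => simp only [map_add, hs, ht, TensorProduct.add_tmul]
  | tmul a b => simp [emb12, TensorProduct.smul_tmul']

theorem counitFirst_comulRight (R : A ⊗[ℂ] A) :
    counitFirst χ (comulRight Δ R) = Δ (counitLeft χ R) := by
  induction R with
  | zero => simp
  | add s t hs ht => simp only [map_add, hs, ht]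
  | tmul a b => simp [comulRight]

theorem counitLeft_counitFirst_assoc_tmul (s : A ⊗[ℂ] A) (b : A) :
    counitLeft ψ (counitFirst χ (Algebra.TensorProduct.assoc ℂ ℂ ℂ A A A (s ⊗ₜ b))) =
      ψ (counitLeft χ s) • b := by
  induction s with
  | zero => simp
  | add s t hs ht => simp only [TensorProduct.add_tmul, map_add, hs, ht, add_smul]
  | tmul c d => simp [mul_smul]

theorem counitLeft_counitFirst_comulLeft (R : A ⊗[ℂ] A) :
    counitLeft ψ (counitFirst χ (comulLeft Δ R)) = counitLeft (charMul Δ χ ψ) R := by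
  induction R with
  | zero => simp
  | add s t hs ht => simp only [map_add, hs, ht]
  | tmul a b =>
    rw [counitLeft_tmul]
    exact counitLeft_counitFirst_assoc_tmul χ ψ (Δ a) b

end CharacterSlices

section RMatrix

theorem map_inverse_eq_one {M N F : Type*} [MonoidWithZero M] [Monoid N] [FunLike F M N]
    [MonoidHomClass F M N] {f : F} {x : M} (hx : IsUnit x) (h : f x = 1) :
    f (Ring.inverse x) = 1 := by
  rw [← map_one f, ← Ring.mul_inverse_cancel x hx, map_mul, h, one_mul]

variable {A : Type} [Ring A] [Algebra ℂ A] {Δ : A →ₐ[ℂ] A ⊗[ℂ] A} {Φ : A ⊗[ℂ] (A ⊗[ℂ] A)}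
  {R : A ⊗[ℂ] A} {χ : A →ₐ[ℂ] ℂ}

theorem AssociatesStrictly.first_perm132 (hχ : AssociatesStrictly χ Φ) :
    counitFirst χ (perm132 Φ) = 1 := by
  rw [counitFirst_perm132, hχ.first, map_one]

theorem AssociatesStrictly.first_perm213 (hχ : AssociatesStrictly χ Φ) :
    counitFirst χ (perm213 Φ) = 1 := by
  rw [counitFirst_perm213, hχ.middle]

theorem AssociatesStrictly.first_perm231 (hχ : AssociatesStrictly χ Φ) :
    counitFirst χ (perm231 Φ) = 1 := by
  rw [perm231, AlgHom.comp_apply, counitFirst_perm132, hχ.first_perm213, map_one]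

theorem AssociatesStrictly.first_perm312 (hχ : AssociatesStrictly χ Φ) :
    counitFirst χ (perm312 Φ) = 1 := by
  rw [perm312, AlgHom.comp_apply, counitFirst_perm213, counitMiddle_perm132, hχ.last]

namespace IsUniversalRMatrix

theorem comul_counitLeft (hR : IsUniversalRMatrix Δ Φ R) (hΦ : IsUnit Φ)
    (hχ : AssociatesStrictly χ Φ) : Δ (counitLeft χ R) = counitLeft χ R ⊗ₜ counitLeft χ R := by
  have h_inverse : counitFirst χ (Ring.inverse (perm213 Φ)) = 1 :=
    map_inverse_eq_one (hΦ.map perm213) hχ.first_perm213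
  rw [← counitFirst_comulRight, hR.hexagon_right]
  simp only [map_mul, hχ.first_perm312, h_inverse, hχ.first, counitFirst_emb13,
    counitFirst_emb12, one_mul, mul_one, Algebra.TensorProduct.tmul_mul_tmul]

theorem counitLeft_charMul (hR : IsUniversalRMatrix Δ Φ R) (hΦ : IsUnit Φ)
    (hχ : AssociatesStrictly χ Φ) (ψ : A →ₐ[ℂ] ℂ) :
    counitLeft (charMul Δ χ ψ) R = counitLeft χ R * counitLeft ψ R := by
  have h_inverse : counitFirst χ (Ring.inverse Φ) = 1 :=
    map_inverse_eq_one hΦ hχ.first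
  have h_inverse_perm : counitFirst χ (Ring.inverse (perm231 Φ)) = 1 :=
    map_inverse_eq_one (hΦ.map perm231) hχ.first_perm231
  rw [← counitLeft_counitFirst_comulLeft, hR.hexagon_left]
  simp only [map_mul, h_inverse, h_inverse_perm, hχ.first_perm132, counitFirst_emb13,
    counitFirst_emb23, one_mul, mul_one, counitLeft_tmul, map_one, one_smul]

theorem counitLeft_mul_counitLeft_comul (hR : IsUniversalRMatrix Δ Φ R) (χ : A →ₐ[ℂ] ℂ) (a : A) :
    counitLeft χ R * counitLeft χ (Δ a) = counitRight χ (Δ a) * counitLeft χ R := by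
  rw [← map_mul, hR.intertwine, map_mul, counitLeft_comm]

end IsUniversalRMatrix

end RMatrix

section Counit

theorem isGroupLikeElem_of_isUnit {R A : Type*} [CommSemiring R] [Semiring A] [Bialgebra R A]
    {r : A} (hr : IsUnit r) (h : Coalgebra.comul (R := R) r = r ⊗ₜ r) : IsGroupLikeElem R r where
  counit_eq_one := by
    have h_smul : Coalgebra.counit (R := R) r • r = r := by
      simpa [h] using congrArg (TensorProduct.lid R A) (Coalgebra.rTensor_counit_comul (R := R) r)
    rw [Algebra.smul_def] at h_smul
    simpa using congrArg (Coalgebra.counit (R := R)) (hr.mul_eq_right.mp h_smul)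
  comul_eq_tmul_self := h

variable {A : Type} [Ring A] [Bialgebra ℂ A]

theorem charMul_counit_left (χ : A →ₐ[ℂ] ℂ) :
    charMul (Bialgebra.comulAlgHom ℂ A) (Bialgebra.counitAlgHom ℂ A) χ = χ :=
  AlgHom.ext fun a => congrArg χ (counitLeft_comul a)

variable {Φ : A ⊗[ℂ] (A ⊗[ℂ] A)} {R : A ⊗[ℂ] A}

theorem IsUniversalRMatrix.counitLeft_counit
    (hR : IsUniversalRMatrix (Bialgebra.comulAlgHom ℂ A) Φ R) (hΦ : IsUnit Φ)
    (hϵ : AssociatesStrictly (Bialgebra.counitAlgHom ℂ A) Φ) :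
    counitLeft (Bialgebra.counitAlgHom ℂ A) R = 1 := by
  have h := hR.counitLeft_charMul hΦ hϵ (Bialgebra.counitAlgHom ℂ A)
  rw [charMul_counit_left] at h
  exact (hR.isUnit.map (counitLeft (Bialgebra.counitAlgHom ℂ A))).mul_eq_left.mp h.symm

theorem IsUniversalRMatrix.isGroupLikeElem_counitLeft
    (hR : IsUniversalRMatrix (Bialgebra.comulAlgHom ℂ A) Φ R) (hΦ : IsUnit Φ) {χ : A →ₐ[ℂ] ℂ}
    (hχ : AssociatesStrictly χ Φ) : IsGroupLikeElem ℂ (counitLeft χ R) :=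
  isGroupLikeElem_of_isUnit (hR.isUnit.map (counitLeft χ)) (hR.comul_counitLeft hΦ hχ)

end Counit

end QB

namespace ResQ

theorem apply_eq_counit_smul {V : Type*} [AddCommGroup V] [Module ℂ V]
    {σ : Q →ₐ[ℂ] Module.End ℂ V} {w : V} (hE : σ E w = 0) (hF : σ F w = 0) (hK : σ K w = w)
    (a : Q) : σ a w = counit a • w := by
  induction a using gen_induction with
  | algebraMap c => rw [AlgHom.commutes, AlgHom.commutes]; rfl
  | gen g =>
    match g with
    | .E => exact hE.trans (by rw [← E, counit_E, zero_smul])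
    | .F => exact hF.trans (by rw [← F, counit_F, zero_smul])
    | .K => exact hK.trans (by rw [← K, counit_K, one_smul])
    | .Kinv =>
      have h_counit : counit Kinv = 1 := lift_Kinv _
      have h : σ Kinv (σ K w) = w := by
        rw [← Module.End.mul_apply, ← map_mul, sat_gen.k'_k, map_one, Module.End.one_apply]
      rw [hK] at h
      exact h.trans (by rw [← Kinv, h_counit, one_smul])
  | mul a b ha hb =>
    rw [map_mul, Module.End.mul_apply, hb, map_smul, ha, smul_smul, map_mul, mul_comm]
  | add a b ha hb => rw [map_add, LinearMap.add_apply, ha, hb, map_add, add_smul]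

theorem sat_sign : Sat (0 : ℂ) 0 (-1) (-1) := by
  constructor <;> norm_num

/-- The character with `E, F ↦ 0` and `K ↦ -1`, i.e. the nontrivial one-dimensional module on which
`K²` acts as the identity. -/
noncomputable def sign : Q →ₐ[ℂ] ℂ := lift sat_sign

theorem sign_E : sign E = 0 := lift_E _
theorem sign_F : sign F = 0 := lift_F _
theorem sign_K : sign K = -1 := lift_K _
theorem sign_Kinv : sign Kinv = -1 := lift_Kinv _

theorem sign_e_zero : sign (e 0) = 1 := by
  rw [e_zero, map_smul, map_add, map_one, map_pow, sign_K]
  norm_num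

theorem charMul_sign_sign : QB.charMul comul sign sign = counit := by
  apply hom_ext <;> simp [QB.charMul, comul, sign, counit]

theorem counitLeft_sign_comul_E : QB.counitLeft sign (comul E) = E := by
  simp [comul_E, sign_E]

theorem counitRight_sign_comul_E : QB.counitRight sign (comul E) = -E := by
  simp [comul_E, sign_E, sign_K]

theorem counitLeft_sign_comul_F : QB.counitLeft sign (comul F) = -F := by
  simp [comul_F, sign_F, sign_Kinv]

theorem counitRight_sign_comul_F : QB.counitRight sign (comul F) = F := by
  simp [comul_F, sign_F]

theorem sat_steinberg : Sat (!![0, 1; 0, 0] : Matrix (Fin 2) (Fin 2) ℂ) !![0, 0; 1, 0]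
    !![Complex.I, 0; 0, -Complex.I] !![-Complex.I, 0; 0, Complex.I] := by
  have h : (Complex.I - Complex.I⁻¹)⁻¹ * (Complex.I - -Complex.I) = 1 := by
    rw [Complex.inv_I]; exact inv_mul_cancel₀ (by simp [← two_mul])
  have h' : (Complex.I - Complex.I⁻¹)⁻¹ * (-Complex.I - Complex.I) = -1 := by
    linear_combination -h
  constructor
  · simp [Matrix.one_fin_two]
  · simp [Matrix.one_fin_two]
  · ext i j; fin_cases i <;> fin_cases j <;> simp
  · ext i j; fin_cases i <;> fin_cases j <;> simp
  · simp [-Complex.inv_I, -sub_neg_eq_add, h, h']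
  · ext i j; fin_cases i <;> fin_cases j <;> simp [sq]
  · ext i j; fin_cases i <;> fin_cases j <;> simp [sq]
  · simp [pow_succ, Matrix.one_fin_two]

/-- The Steinberg representation: the two-dimensional simple module of highest weight `i`. -/
noncomputable def steinberg : Q →ₐ[ℂ] Module.End ℂ (Fin 2 → ℂ) :=
  (Matrix.toLinAlgEquiv' (R := ℂ) (n := Fin 2)).toAlgHom.comp (lift sat_steinberg)

theorem steinberg_E (v : Fin 2 → ℂ) : steinberg E v = v 1 • ![1, 0] := by
  ext i; fin_cases i <;> simp [steinberg, Matrix.toLinAlgEquiv'_apply, Matrix.mulVec, dotProduct]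

theorem steinberg_F (v : Fin 2 → ℂ) : steinberg F v = v 0 • ![0, 1] := by
  ext i; fin_cases i <;> simp [steinberg, Matrix.toLinAlgEquiv'_apply, Matrix.mulVec, dotProduct]

theorem steinberg_K (v : Fin 2 → ℂ) :
    steinberg K v = ![Complex.I * v 0, -Complex.I * v 1] := by
  ext i; fin_cases i <;> simp [steinberg, Matrix.toLinAlgEquiv'_apply, Matrix.mulVec, dotProduct]

theorem steinberg_Kinv (v : Fin 2 → ℂ) :
    steinberg Kinv v = ![-Complex.I * v 0, Complex.I * v 1] := by
  ext i; fin_cases i <;> simp [steinberg, Matrix.toLinAlgEquiv'_apply, Matrix.mulVec, dotProduct]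

/-- The invariant vector in the tensor square of the Steinberg representation. -/
noncomputable def invariant : (Fin 2 → ℂ) ⊗[ℂ] (Fin 2 → ℂ) :=
  ![0, 1] ⊗ₜ[ℂ] ![1, 0] - Complex.I • (![1, 0] ⊗ₜ[ℂ] ![0, 1])

theorem invariant_ne_zero : invariant ≠ 0 := by
  intro h
  have h_coord := congrArg (LinearMap.mul' ℂ ℂ ∘ₗ
    TensorProduct.map (LinearMap.proj (R := ℂ) (φ := fun _ : Fin 2 => ℂ) 1)
      (LinearMap.proj (R := ℂ) (φ := fun _ : Fin 2 => ℂ) 0)) h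
  simp [invariant] at h_coord

theorem act_comul_invariant (a : Q) :
    FinRep.act steinberg steinberg (comul a) invariant = counit a • invariant := by
  have hK_up : steinberg K ![1, 0] = Complex.I • ![1, 0] := by simp [steinberg_K]
  have hK_down : steinberg K ![0, 1] = (-Complex.I) • ![0, 1] := by simp [steinberg_K]
  have hKinv_down : steinberg Kinv ![0, 1] = Complex.I • ![0, 1] := by simp [steinberg_Kinv]
  refine apply_eq_counit_smul (σ := (FinRep.act steinberg steinberg).comp comul) ?_ ?_ ?_ a
  · rw [AlgHom.comp_apply, comul_E]
    simp [invariant, steinberg_E, hK_up, -Matrix.smul_cons]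
  · rw [AlgHom.comp_apply, comul_F]
    simp [invariant, steinberg_F, hKinv_down, -Matrix.smul_cons, ← TensorProduct.smul_tmul']
  · rw [AlgHom.comp_apply, comul_K]
    simp only [invariant, map_sub, map_smul, FinRep.act_tmul, hK_up, hK_down,
      TensorProduct.tmul_smul, ← TensorProduct.smul_tmul', smul_smul, neg_mul, mul_neg,
      Complex.I_mul_I, neg_neg, one_smul]

theorem map_invariant_eq_neg {T : Module.End ℂ (Fin 2 → ℂ)}
    (hE : ∀ v, T (steinberg E v) = -steinberg E (T v))
    (hF : ∀ v, T (steinberg F v) = -steinberg F (T v)) (hT : Function.Involutive T) :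
    TensorProduct.map T T invariant = -invariant := by
  obtain ⟨c, h_up⟩ : ∃ c : ℂ, T ![1, 0] = c • ![1, 0] := by
    have h := hE ![0, 1]
    rw [steinberg_E, steinberg_E, ← neg_smul] at h
    exact ⟨_, by simpa using h⟩
  have h_down : T ![0, 1] = -c • ![0, 1] := by
    have h := hF ![1, 0]
    rw [steinberg_F, steinberg_F, h_up] at h
    simpa using h
  have hc : c * c = 1 := by
    have h := hT ![1, 0]
    rw [h_up, map_smul, h_up] at h
    simpa using congrFun h 0
  simp only [invariant, map_sub, map_smul, TensorProduct.map_tmul, h_up, h_down,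
    TensorProduct.tmul_smul, ← TensorProduct.smul_tmul', smul_smul, mul_neg, neg_mul, hc]
  module

theorem map_invariant_ne {T : Module.End ℂ (Fin 2 → ℂ)}
    (h_comm : ∀ a v, T (steinberg (QB.counitLeft sign (comul a)) v) =
      steinberg (QB.counitRight sign (comul a)) (T v))
    (hT : Function.Involutive T) : TensorProduct.map T T invariant ≠ invariant := by
  have hE (v) : T (steinberg E v) = -steinberg E (T v) := by
    simpa [counitLeft_sign_comul_E, counitRight_sign_comul_E] using h_comm E v
  have hF (v) : T (steinberg F v) = -steinberg F (T v) := by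
    simpa [counitLeft_sign_comul_F, counitRight_sign_comul_F, neg_eq_iff_eq_neg] using h_comm F v
  have : IsAddTorsionFree ((Fin 2 → ℂ) ⊗[ℂ] (Fin 2 → ℂ)) := .of_isTorsionFree ℂ _
  rw [map_invariant_eq_neg hE hF hT, ne_eq, neg_eq_self]
  exact invariant_ne_zero

theorem not_isQuasiTriangular (ε : ℂˣ) : ¬ QB.IsQuasiTriangular comul (Phi ε) := by
  rintro ⟨R, hR⟩
  set r := QB.counitLeft sign R
  have h_sign := associatesStrictly_Phi sign_e_zero ε
  have h_counit : QB.counitLeft counit R = 1 :=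
    hR.counitLeft_counit (isUnit_Phi ε) (associatesStrictly_Phi isCentralGrading_e.counit_zero ε)
  have h_sq : r * r = 1 := by
    rw [← h_counit, ← charMul_sign_sign, hR.counitLeft_charMul (isUnit_Phi ε) h_sign]
  have h_grouplike : IsGroupLikeElem ℂ r := hR.isGroupLikeElem_counitLeft (isUnit_Phi ε) h_sign
  refine map_invariant_ne (T := steinberg r) (fun a v => ?_) (fun v => ?_) ?_
  · rw [← Module.End.mul_apply, ← Module.End.mul_apply, ← map_mul steinberg, ← map_mul steinberg,
      hR.counitLeft_mul_counitLeft_comul]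
  · rw [← Module.End.mul_apply, ← map_mul, h_sq, map_one, Module.End.one_apply]
  · have h_comul : comul r = r ⊗ₜ r := h_grouplike.comul_eq_tmul_self
    have h_counit_r : counit r = 1 := h_grouplike.counit_eq_one
    have h := act_comul_invariant r
    rwa [h_comul, h_counit_r, one_smul, FinRep.act, AlgHom.comp_apply,
      Algebra.TensorProduct.map_tmul, Module.endTensorEndAlgHom_apply] at h

theorem not_isBialgebraRMatrix (R : Q ⊗[ℂ] Q) : ¬ QB.IsBialgebraRMatrix comul R := fun hR =>
  not_isQuasiTriangular 1 ⟨R, hR.isUnit, hR.intertwine,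
    by simp [Phi_one, hR.hexagon_left], by simp [Phi_one, hR.hexagon_right]⟩

end ResQ

namespace FinRep

open MonoidalCategory

variable {A : Type} [Ring A] [Bialgebra ℂ A]

/-- The one-dimensional representation given by a character. -/
def ofChar (χ : A →ₐ[ℂ] ℂ) : FinRep A where
  V := ℂ
  ρ := (Algebra.lmul ℂ ℂ).comp χ

/-- The multiplication `ℂ ⊗ ℂ → ℂ` as an intertwiner between one-dimensional representations. -/
def ofCharMul (χ ψ : A →ₐ[ℂ] ℂ) :
    ofChar χ ⊗ ofChar ψ ⟶ ofChar (QB.charMul (Bialgebra.comulAlgHom ℂ A) χ ψ) :=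
  ⟨(TensorProduct.lid ℂ ℂ).toLinearMap, fun a x =>
    lid_act ((Algebra.lmul ℂ ℂ).comp ψ) χ (Coalgebra.comul (R := ℂ) a) x⟩

variable [BraidedCategory (FinRep A)] (χ ψ : A →ₐ[ℂ] ℂ)

/-- The braiding with a one-dimensional representation, as an endomorphism of the underlying
vector space. -/
noncomputable def charBraiding (Y : FinRep A) : Module.End ℂ Y.V :=
  (TensorProduct.rid ℂ Y.V).toLinearMap ∘ₗ (β_ (ofChar χ) Y).hom.map ∘ₗ
    (TensorProduct.lid ℂ Y.V).symm.toLinearMap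

theorem braiding_one_tmul (Y : FinRep A) (y : Y.V) :
    (β_ (ofChar χ) Y).hom.map ((1 : ℂ) ⊗ₜ[ℂ] y) = charBraiding χ Y y ⊗ₜ[ℂ] (1 : ℂ) :=
  ((TensorProduct.rid ℂ Y.V).symm_apply_apply _).symm

theorem charBraiding_comm (Y : FinRep A) (a : A) (y : Y.V) :
    charBraiding χ Y (Y.ρ (QB.counitLeft χ (Bialgebra.comulAlgHom ℂ A a)) y) =
      Y.ρ (QB.counitRight χ (Bialgebra.comulAlgHom ℂ A a)) (charBraiding χ Y y) := by
  have h_left := lid_act Y.ρ χ (Coalgebra.comul (R := ℂ) a) ((1 : ℂ) ⊗ₜ[ℂ] y)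
  have h_right := rid_act Y.ρ χ (Coalgebra.comul (R := ℂ) a)
    (charBraiding χ Y y ⊗ₜ[ℂ] (1 : ℂ))
  have h_braiding := (β_ (ofChar χ) Y).hom.comm a ((1 : ℂ) ⊗ₜ[ℂ] y)
  rw [braiding_one_tmul] at h_braiding
  rw [TensorProduct.lid_tmul, one_smul, ← LinearEquiv.eq_symm_apply] at h_left
  rw [TensorProduct.rid_tmul, one_smul] at h_right
  refine Eq.trans ?_ ((congrArg (TensorProduct.rid ℂ Y.V) h_braiding).trans h_right)
  exact congrArg (fun z => TensorProduct.rid ℂ Y.V ((β_ (ofChar χ) Y).hom.map z)) h_left.symm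

theorem charBraiding_naturality {Y Z : FinRep A} (f : Y ⟶ Z) (y : Y.V) :
    charBraiding χ Z (f.map y) = f.map (charBraiding χ Y y) := by
  have h := congrArg (fun g => TensorProduct.rid ℂ Z.V (Hom.map g ((1 : ℂ) ⊗ₜ[ℂ] y)))
    (BraidedCategory.braiding_naturality_right (ofChar χ) f)
  refine Eq.trans h ?_
  change TensorProduct.rid ℂ Z.V (TensorProduct.map f.map LinearMap.id
    ((β_ (ofChar χ) Y).hom.map ((1 : ℂ) ⊗ₜ[ℂ] y))) = _
  rw [braiding_one_tmul]
  exact (TensorProduct.rid_tmul (R := ℂ) _ _).trans (one_smul ℂ _)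

theorem charBraiding_unit (z : ℂ) : charBraiding χ (unit : FinRep A) z = z := by
  have h_lid := congrArg (TensorProduct.lid ℂ ℂ) (braiding_one_tmul χ (unit : FinRep A) z)
  have h_braiding : TensorProduct.lid ℂ ℂ ((β_ (ofChar χ) (unit : FinRep A)).hom.map
      ((1 : ℂ) ⊗ₜ[ℂ] z)) = z :=
    (congrArg (fun g => TensorProduct.lid ℂ ℂ (Hom.map g ((1 : ℂ) ⊗ₜ[ℂ] z)))
      (braiding_tensorUnit_right (ofChar χ))).trans ((one_smul ℂ _).trans (mul_one z))
  exact (mul_one (M := ℂ) (charBraiding χ (unit : FinRep A) z)).symm.trans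
    (h_lid.symm.trans h_braiding)

theorem charBraiding_counit (Y : FinRep A) :
    charBraiding (Bialgebra.counitAlgHom ℂ A) Y = 1 := by
  refine LinearMap.ext fun y => ?_
  have h := congrArg (fun g => TensorProduct.rid ℂ Y.V (Hom.map g ((1 : ℂ) ⊗ₜ[ℂ] y)))
    (braiding_tensorUnit_left Y)
  refine h.trans ?_
  change TensorProduct.rid ℂ Y.V ((TensorProduct.rid ℂ Y.V).symm ((1 : ℂ) • y)) = y
  rw [LinearEquiv.apply_symm_apply, one_smul]

theorem charBraiding_tensor (Y Z : FinRep A) :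
    charBraiding χ (tensor Y Z) = TensorProduct.map (charBraiding χ Y) (charBraiding χ Z) := by
  refine TensorProduct.ext' fun y z => ?_
  have h_hexagon := congrArg (fun g => Hom.map g (((1 : ℂ) ⊗ₜ[ℂ] y) ⊗ₜ[ℂ] z))
    (BraidedCategory.hexagon_forward (ofChar χ) Y Z)
  have h_left : Hom.map ((α_ (ofChar χ) Y Z).hom ≫ (β_ (ofChar χ) (Y ⊗ Z)).hom ≫
      (α_ Y Z (ofChar χ)).hom) (((1 : ℂ) ⊗ₜ[ℂ] y) ⊗ₜ[ℂ] z) =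
      TensorProduct.assoc ℂ Y.V Z.V ℂ
        (charBraiding χ (tensor Y Z) (y ⊗ₜ[ℂ] z) ⊗ₜ[ℂ] (1 : ℂ)) :=
    congrArg (TensorProduct.assoc ℂ Y.V Z.V ℂ)
      (braiding_one_tmul χ (tensor Y Z) (y ⊗ₜ[ℂ] z))
  have h_right : Hom.map (((β_ (ofChar χ) Y).hom ▷ Z) ≫ (α_ Y (ofChar χ) Z).hom ≫
      (Y ◁ (β_ (ofChar χ) Z).hom)) (((1 : ℂ) ⊗ₜ[ℂ] y) ⊗ₜ[ℂ] z) =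
      charBraiding χ Y y ⊗ₜ[ℂ] (charBraiding χ Z z ⊗ₜ[ℂ] (1 : ℂ)) := by
    change TensorProduct.map LinearMap.id (β_ (ofChar χ) Z).hom.map
      (TensorProduct.assoc ℂ Y.V ℂ Z.V
        ((β_ (ofChar χ) Y).hom.map ((1 : ℂ) ⊗ₜ[ℂ] y) ⊗ₜ[ℂ] z)) = _
    rw [braiding_one_tmul]
    exact congrArg (charBraiding χ Y y ⊗ₜ[ℂ] ·) (braiding_one_tmul χ Z z)
  have h := congrArg (fun t => TensorProduct.rid ℂ (Y.V ⊗[ℂ] Z.V)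
    ((TensorProduct.assoc ℂ Y.V Z.V ℂ).symm t)) (h_left.symm.trans (h_hexagon.trans h_right))
  simp only [LinearEquiv.symm_apply_apply, TensorProduct.assoc_symm_tmul,
    TensorProduct.rid_tmul, one_smul] at h
  exact (one_smul ℂ (charBraiding χ (tensor Y Z) (y ⊗ₜ[ℂ] z))).symm.trans h

theorem braiding_ofChar_tensor_ofChar (Y : FinRep A) (y : Y.V) :
    (β_ (ofChar χ ⊗ ofChar ψ) Y).hom.map (((1 : ℂ) ⊗ₜ[ℂ] (1 : ℂ)) ⊗ₜ[ℂ] y) =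
      charBraiding χ Y (charBraiding ψ Y y) ⊗ₜ[ℂ] ((1 : ℂ) ⊗ₜ[ℂ] (1 : ℂ)) := by
  have h_hexagon := congrArg (fun g => Hom.map g ((1 : ℂ) ⊗ₜ[ℂ] ((1 : ℂ) ⊗ₜ[ℂ] y)))
    (BraidedCategory.hexagon_reverse (ofChar χ) (ofChar ψ) Y)
  have h_right : Hom.map ((ofChar χ ◁ (β_ (ofChar ψ) Y).hom) ≫
      (α_ (ofChar χ) Y (ofChar ψ)).inv ≫ ((β_ (ofChar χ) Y).hom ▷ ofChar ψ))
      ((1 : ℂ) ⊗ₜ[ℂ] ((1 : ℂ) ⊗ₜ[ℂ] y)) =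
      (charBraiding χ Y (charBraiding ψ Y y) ⊗ₜ[ℂ] (1 : ℂ)) ⊗ₜ[ℂ] (1 : ℂ) := by
    change TensorProduct.map (β_ (ofChar χ) Y).hom.map LinearMap.id
      ((TensorProduct.assoc ℂ ℂ Y.V ℂ).symm
        ((1 : ℂ) ⊗ₜ[ℂ] ((β_ (ofChar ψ) Y).hom.map ((1 : ℂ) ⊗ₜ[ℂ] y)))) = _
    rw [braiding_one_tmul]
    exact congrArg (· ⊗ₜ[ℂ] (1 : ℂ)) (braiding_one_tmul χ Y (charBraiding ψ Y y))
  exact (LinearEquiv.symm_apply_eq (TensorProduct.assoc ℂ Y.V ℂ ℂ)).mp (h_hexagon.trans h_right)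

theorem charBraiding_charMul (Y : FinRep A) :
    charBraiding (QB.charMul (Bialgebra.comulAlgHom ℂ A) χ ψ) Y =
      charBraiding χ Y * charBraiding ψ Y := by
  refine LinearMap.ext fun y => ?_
  have h_naturality := congrArg (fun g => Hom.map g (((1 : ℂ) ⊗ₜ[ℂ] (1 : ℂ)) ⊗ₜ[ℂ] y))
    (BraidedCategory.braiding_naturality_left (ofCharMul χ ψ) Y)
  have h_left : Hom.map ((ofCharMul χ ψ ▷ Y) ≫
      (β_ (ofChar (QB.charMul (Bialgebra.comulAlgHom ℂ A) χ ψ)) Y).hom)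
      (((1 : ℂ) ⊗ₜ[ℂ] (1 : ℂ)) ⊗ₜ[ℂ] y) =
      charBraiding (QB.charMul (Bialgebra.comulAlgHom ℂ A) χ ψ) Y y ⊗ₜ[ℂ] (1 : ℂ) := by
    change (β_ (ofChar (QB.charMul (Bialgebra.comulAlgHom ℂ A) χ ψ)) Y).hom.map
      (((1 : ℂ) • (1 : ℂ)) ⊗ₜ[ℂ] y) = _
    rw [one_smul, braiding_one_tmul]
  have h_right : Hom.map ((β_ (ofChar χ ⊗ ofChar ψ) Y).hom ≫ (Y ◁ ofCharMul χ ψ))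
      (((1 : ℂ) ⊗ₜ[ℂ] (1 : ℂ)) ⊗ₜ[ℂ] y) =
      charBraiding χ Y (charBraiding ψ Y y) ⊗ₜ[ℂ] ((1 : ℂ) • (1 : ℂ)) :=
    congrArg (TensorProduct.map LinearMap.id (TensorProduct.lid ℂ ℂ).toLinearMap)
      (braiding_ofChar_tensor_ofChar χ ψ Y y)
  have h := congrArg (TensorProduct.rid ℂ Y.V) (h_left.symm.trans (h_naturality.trans h_right))
  simpa using h

end FinRep

namespace ResQ

open FinRep

/-- `steinberg` as an object of the category of representations. -/
noncomputable def steinbergRep : FinRep Q where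
  V := Fin 2 → ℂ
  ρ := steinberg

/-- `invariant` as a morphism from the unit object. -/
noncomputable def invariantHom : (unit : FinRep Q) ⟶ tensor steinbergRep steinbergRep :=
  ⟨LinearMap.toSpanSingleton ℂ _ invariant, fun a (z : ℂ) => by
    change (counit a * z) • invariant = act steinberg steinberg (comul a) (z • invariant)
    rw [map_smul, act_comul_invariant, smul_smul, mul_comm]⟩

theorem invariantHom_one : invariantHom.map (1 : ℂ) = invariant := one_smul ℂ invariant

theorem charBraiding_sign_involutive [BraidedCategory (FinRep Q)] (Y : FinRep Q) :
    Function.Involutive (charBraiding sign Y) := fun y => by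
  have h := charBraiding_charMul sign sign Y
  rw [show QB.charMul (Bialgebra.comulAlgHom ℂ Q) sign sign = Bialgebra.counitAlgHom ℂ Q from
    charMul_sign_sign, charBraiding_counit] at h
  exact (LinearMap.congr_fun h y).symm

theorem isEmpty_braidedCategory : IsEmpty (BraidedCategory (FinRep Q)) := by
  refine ⟨fun _ => map_invariant_ne (T := charBraiding sign steinbergRep)
    (charBraiding_comm sign steinbergRep) (charBraiding_sign_involutive steinbergRep) ?_⟩
  have h := charBraiding_naturality sign invariantHom (1 : ℂ)
  rwa [charBraiding_unit, invariantHom_one, charBraiding_tensor] at h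

end ResQ

theorem mainTheorem2 :
    (∀ ε : ℂˣ, ε = 1 ∨ ε = -1 →
      ResQ.IsNormalisedThreeCocycle (ResQ.phi ε) ∧
      ResQ.Phi ε = 1 ⊗ₜ[ℂ] (1 ⊗ₜ[ℂ] 1) +
        ((ε : ℂ) - 1) • (ResQ.e 1 ⊗ₜ[ℂ] (ResQ.e 1 ⊗ₜ[ℂ] ResQ.e 1)) ∧
      QB.IsQuasiBialgebra ResQ.comul ResQ.counit (ResQ.Phi ε) ∧
      ¬ QB.IsQuasiTriangular ResQ.comul (ResQ.Phi ε)) ∧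
    (¬ ∃ R : ResQ.Q ⊗[ℂ] ResQ.Q, QB.IsBialgebraRMatrix ResQ.comul R) ∧
    IsEmpty (BraidedCategory (FinRep ResQ.Q)) := by
  refine ⟨fun ε hε => ?_, fun ⟨R, hR⟩ => ResQ.not_isBialgebraRMatrix R hR,
    ResQ.isEmpty_braidedCategory⟩
  have hsq : ε * ε = 1 := by rcases hε with rfl | rfl <;> simp
  exact ⟨ResQ.phi_isNormalisedThreeCocycle hsq, ResQ.Phi_eq ε, ResQ.isQuasiBialgebra_Phi hsq,
    ResQ.not_isQuasiTriangular ε⟩
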